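/- Let $(\mathcal Y,\mathcal A)$ be a measurable space, $\mathcal P$ the set of all probability measures on it, $\alpha\in(0,\infty]$, and $\mathcal W\subset\mathcal P$ nonempty. For $W,Q\in\mathcal P$ and any reference measure $\nu$ with $W,Q\ll\nu$, let $D_\alpha(W\|Q)$ be the order $\alpha$ Rényi divergence: $\frac1{\alpha-1}\ln\int(\frac{dW}{d\nu})^{\alpha}(\frac{dQ}{d\nu})^{1-\alpha}d\nu$ for $\alpha\in(0,\infty)\setminus\{1\}$, the Kullback–Leibler divergence for $\alpha=1$, and $\ln\operatorname{ess\,sup}_\nu\frac{dW/d\nu}{dQ/d\nu}$ for $\alpha=\infty$. For a probability mass function $P$ with finite support contained in $\mathcal W$, and any reference measure $\nu$ for its support, let $\mu_{\alpha,P}$ be the measure with density $\left(\sum_W P(W)(\frac{dW}{d\nu})^\alpha\right)^{1/\alpha}$ with respect to $\nu$ if $\alpha<\infty$, and $\max_{W:P(W)>0}\frac{dW}{d\nu}$ if $\alpha=\infty$. The order $\alpha$ Rényi information $I_\alpha(P;\mathcal W)$ is $\frac{\alpha}{\alpha-1}\ln\mu_{\alpha,P}(\mathcal Y)$ for $\alpha\in(0,\infty)\setminus\{1\}$,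 $\ln\mu_{\infty,P}(\mathcal Y)$ for $\alpha=\infty$, and, for $\alpha=1$, the mutual information $\int\sum_W P(W|y)\ln\frac{P(W|y)}{P(W)}\,\mu_{1,P}(dy)$, where $P(W|y)=P(W)\frac{dW}{d\mu_{1,P}}(y)$. The Rényi capacity is $C_\alpha(\mathcal W)=\sup_P I_\alpha(P;\mathcal W)$, over all such $P$, and the Rényi radius is $S_\alpha(\mathcal W)=\inf_{Q\in\mathcal P}\sup_{W\in\mathcal W}D_\alpha(W\|Q)$. Suppose $C_\alpha(\mathcal W)<\infty$. Then $C_\alpha(\mathcal W)=S_\alpha(\mathcal W)$; there is a unique $q_{\alpha,\mathcal W}\in\mathcal P$ (the order $\alpha$ Rényi center) with $$C_\alpha(\mathcal W)=\sup_{W\in\mathcal W}D_\alpha(W\|q_{\alpha,\mathcal W});$$ and for every $Q\in\mathcal P$, $$\sup_{W\in\mathcal W}D_\alpha(W\|Q)\ \ge\ C_\alpha(\mathcal W)+D_\alpha(q_{\alpha,\mathcal W}\|Q).$$ -/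

import Mathlib

open MeasureTheory
open scoped ENNReal NNReal

noncomputable section

namespace Renyi

variable {Ω : Type*} [MeasurableSpace Ω]

/-- The order `α ∈ [0, ∞]` Rényi divergence `D_α(W‖Q)` of probability measures, with values in the
extended reals. The densities are taken with respect to the reference measure `W + Q`.
In `ℝ≥0∞` one has `0 ^ (1 - α) = ∞` for `α > 1`, `0 * ∞ = 0`, `x / 0 = ∞` for `x ≠ 0`, and
`ENNReal.log` sends `0` to `-∞` and `∞` to `+∞`, which are the usual conventions here. At order
one the divergence is the Kullback-Leibler divergence. -/
def divergence (α : ℝ≥0∞) (W Q : ProbabilityMeasure Ω) : EReal :=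
  let ν : Measure Ω := (W : Measure Ω) + (Q : Measure Ω)
  let w : Ω → ℝ≥0∞ := (W : Measure Ω).rnDeriv ν
  let q : Ω → ℝ≥0∞ := (Q : Measure Ω).rnDeriv ν
  if α = 0 then -ENNReal.log ((Q : Measure Ω) {y | 0 < w y})
  else if α = 1 then
    ((InformationTheory.klDiv (W : Measure Ω) (Q : Measure Ω) : ℝ≥0∞) : EReal)
  else if α = ∞ then ENNReal.log (essSup (fun y => w y / q y) ν)
  else (((α.toReal - 1)⁻¹ : ℝ) : EReal) *
    ENNReal.log (∫⁻ y, w y ^ α.toReal * q y ^ (1 - α.toReal) ∂ν)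

/-- The priors on `𝒲`: probability mass functions with finite support contained in `𝒲`. -/
def priors (𝒲 : Set (ProbabilityMeasure Ω)) : Set (ProbabilityMeasure Ω →₀ ℝ≥0) :=
  {p | (p.support : Set (ProbabilityMeasure Ω)) ⊆ 𝒲 ∧ ∑ W ∈ p.support, p W = 1}

/-- The mixture `∑_W p(W) W`, which is the order one mean measure of the prior `p`. It is a
reference measure for the support of `p`. -/
def mixture (p : ProbabilityMeasure Ω →₀ ℝ≥0) : Measure Ω :=
  ∑ W ∈ p.support, (p W : ℝ≥0∞) • (W : Measure Ω)

/-- The density of `W` with respect to the mixture of the prior `p`. -/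
def density (p : ProbabilityMeasure Ω →₀ ℝ≥0) (W : ProbabilityMeasure Ω) : Ω → ℝ≥0∞ :=
  (W : Measure Ω).rnDeriv (mixture p)

/-- The order `α` weighted power mean of the densities of the measures in the support of `p`. -/
def meanDensity (α : ℝ≥0∞) (p : ProbabilityMeasure Ω →₀ ℝ≥0) (y : Ω) : ℝ≥0∞ :=
  if α = 0 then ∏ W ∈ p.support, density p W y ^ (p W : ℝ)
  else if α = ∞ then p.support.sup fun W => density p W y
  else (∑ W ∈ p.support, (p W : ℝ≥0∞) * density p W y ^ α.toReal) ^ (α.toReal)⁻¹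

/-- The order `α` mean measure of the prior `p`. -/
def meanMeasure (α : ℝ≥0∞) (p : ProbabilityMeasure Ω →₀ ℝ≥0) : Measure Ω :=
  (mixture p).withDensity (meanDensity α p)

/-- The (order one) posterior probability of `W` given `y`, for the prior `p`. -/
def posterior (p : ProbabilityMeasure Ω →₀ ℝ≥0) (W : ProbabilityMeasure Ω) (y : Ω) : ℝ≥0∞ :=
  p W * density p W y

/-- The order `α ∈ [0, ∞]` Rényi information (in Sibson's sense) of the prior `p`.
The norm of the mean measure is its total mass. -/
def information (α : ℝ≥0∞) (p : ProbabilityMeasure Ω →₀ ℝ≥0) : EReal :=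
  if α = 0 then
    essInf (fun y => ENNReal.log
      ((∑ W ∈ p.support with 0 < posterior p W y, (p W : ℝ≥0∞))⁻¹)) (mixture p)
  else if α = 1 then
    ((∫ y, ∑ W ∈ p.support, (posterior p W y).toReal *
      Real.log ((posterior p W y).toReal / (p W : ℝ)) ∂(mixture p) : ℝ) : EReal)
  else if α = ∞ then ENNReal.log (meanMeasure α p Set.univ)
  else ((α.toReal / (α.toReal - 1) : ℝ) : EReal) * ENNReal.log (meanMeasure α p Set.univ)

/-- The order `α` Rényi capacity of `𝒲`. -/
def capacity (α : ℝ≥0∞) (𝒲 : Set (ProbabilityMeasure Ω)) : EReal :=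
  ⨆ p ∈ priors 𝒲, information α p

/-- The order `α` Rényi radius of `𝒲` relative to `Q`. -/
def relativeRadius (α : ℝ≥0∞) (𝒲 : Set (ProbabilityMeasure Ω)) (Q : ProbabilityMeasure Ω) :
    EReal :=
  ⨆ W ∈ 𝒲, divergence α W Q

/-- The order `α` Rényi radius of `𝒲`. -/
def radius (α : ℝ≥0∞) (𝒲 : Set (ProbabilityMeasure Ω)) : EReal :=
  ⨅ Q : ProbabilityMeasure Ω, relativeRadius α 𝒲 Q

/-- `q` is an order `α` Rényi center of `𝒲`: the capacity is the supremum of the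
divergences `D_α(W‖q)` of the members `W` of `𝒲`. -/
def IsCenter (α : ℝ≥0∞) (𝒲 : Set (ProbabilityMeasure Ω)) (q : ProbabilityMeasure Ω) : Prop :=
  capacity α 𝒲 = ⨆ W ∈ 𝒲, divergence α W q

end Renyi

end

/-!
The proof follows one idea: a prior `p` whose information is close to the capacity has a center
`c p`, the normalized mean measure, which is almost an optimal `Q`, and any sequence of such centers
is Cauchy in total variation. Its limit is the Rényi center; no minimax theorem is needed.

At a finite order `a` the Rényi divergence is replaced by an increasing function of it,
`hellingerDiv`, the integral of a nonnegative kernel which is homogeneous of degree one in the two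
densities. This makes the choice of the reference measure irrelevant, gives lower semicontinuity by
Fatou's lemma and a bound of Pinsker type by a pointwise comparison with the Hellinger distance; all
orders, including one, are covered at once. Moreover, for fixed `Q`, the average of
`hellingerDiv a W Q` over a prior is affine in the prior, and Sibson's identity `exists_sibson`
writes it as `κ i + e ^ ((a - 1) i) * hellingerDiv a c Q`, where `i` is the information, `c` the
center, and `κ` is the function `toHellinger a` translating Rényi divergences into Hellinger
divergences. Applied to a mixture of two nearly optimal priors, with the center of the mixture as
`Q`, it shows that both centers are close to `Q`. Applied to a mixture of a nearly optimal prior and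
a small mass at `W ∈ 𝒲`, it shows that there is a `Q` near the center with `D(W‖Q)` at most slightly
larger than the capacity. Lower semicontinuity then bounds `D(W‖q)` by the capacity for the limit
`q`. Applied to nearly optimal priors with an arbitrary `Q`, Sibson's identity passes to the limit
and yields the lower bound on `sup D(W‖Q)`, which in turn forces uniqueness.

At infinite order, `D(W‖Q) ≤ r` means `W ≤ e ^ r • Q` as measures, and the mean measure of a prior
is the least measure above the members of its support; the same argument applies with averages
replaced by maxima. The part common to all orders is `center_of_sibson`.
-/

namespace Renyi

open Filter Topology

variable {Ω : Type*} [MeasurableSpace Ω]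

/-! ### Closeness in total variation -/

/-- `P` and `Q` are within `η` of each other in total variation. -/
def TVClose (η : ℝ) (P Q : ProbabilityMeasure Ω) : Prop :=
  ∀ A : Set Ω, MeasurableSet A → |(P : Measure Ω).real A - (Q : Measure Ω).real A| ≤ η

lemma TVClose.symm {η : ℝ} {P Q : ProbabilityMeasure Ω} (h : TVClose η P Q) : TVClose η Q P := by
  intro A hA
  rw [abs_sub_comm]
  exact h A hA

lemma TVClose.mono {η η' : ℝ} {P Q : ProbabilityMeasure Ω} (h : TVClose η P Q) (hη : η ≤ η') :
    TVClose η' P Q :=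
  fun A hA => (h A hA).trans hη

lemma TVClose.trans {η η' : ℝ} {P Q R : ProbabilityMeasure Ω} (h : TVClose η P Q)
    (h' : TVClose η' Q R) : TVClose (η + η') P R :=
  fun A hA => (abs_sub_le _ _ _).trans (add_le_add (h A hA) (h' A hA))

lemma TVClose.refl (P : ProbabilityMeasure Ω) : TVClose 0 P P := by
  intro A _
  simp

/-- A one-sided bound on every event suffices: pass to complements. -/
lemma TVClose.of_le {η : ℝ} {P Q : ProbabilityMeasure Ω}
    (h : ∀ A : Set Ω, MeasurableSet A →
      (P : Measure Ω).real A ≤ (Q : Measure Ω).real A + η) : TVClose η P Q := by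
  intro A hA
  have h1 := h A hA
  have h2 := h Aᶜ hA.compl
  rw [probReal_compl_eq_one_sub hA, probReal_compl_eq_one_sub hA] at h2
  rw [abs_le]
  constructor <;> linarith

/-- The `L¹` distance of the densities is at most twice the total variation distance. -/
lemma TVClose.lintegral_edist_le {η : ℝ} {P Q : ProbabilityMeasure Ω} (h : TVClose η P Q)
    (ν : Measure Ω) [IsFiniteMeasure ν] (hP : (P : Measure Ω) ≪ ν) (hQ : (Q : Measure Ω) ≪ ν) :
    ∫⁻ y, edist ((P : Measure Ω).rnDeriv ν y).toReal ((Q : Measure Ω).rnDeriv ν y).toReal ∂ν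
      ≤ ENNReal.ofReal (2 * η) := by
  have hiP : Integrable (fun y => ((P : Measure Ω).rnDeriv ν y).toReal) ν :=
    Measure.integrable_toReal_rnDeriv
  have hiQ : Integrable (fun y => ((Q : Measure Ω).rnDeriv ν y).toReal) ν :=
    Measure.integrable_toReal_rnDeriv
  have hset : ∀ A : Set Ω, ∫ y in A, (((P : Measure Ω).rnDeriv ν y).toReal
      - ((Q : Measure Ω).rnDeriv ν y).toReal) ∂ν
      = (P : Measure Ω).real A - (Q : Measure Ω).real A := by
    intro A
    rw [integral_sub hiP.integrableOn hiQ.integrableOn,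
      Measure.setIntegral_toReal_rnDeriv hP, Measure.setIntegral_toReal_rnDeriv hQ]
  have hmeas : Measurable fun y => ((P : Measure Ω).rnDeriv ν y).toReal
      - ((Q : Measure Ω).rnDeriv ν y).toReal :=
    (Measure.measurable_rnDeriv _ _).ennreal_toReal.sub
      (Measure.measurable_rnDeriv _ _).ennreal_toReal
  have hnorm := integral_norm_eq_pos_sub_neg (hiP.sub hiQ)
  simp only [edist_dist, Real.dist_eq]
  have habs := ofReal_integral_eq_lintegral_ofReal (hiP.sub hiQ).abs
    (Eventually.of_forall fun _ => abs_nonneg _)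
  simp only [Pi.sub_apply, Real.norm_eq_abs] at hnorm habs
  rw [← habs]
  apply ENNReal.ofReal_le_ofReal
  rw [hnorm, hset, hset]
  have h1 := h _ (measurableSet_le (measurable_const (a := (0 : ℝ))) hmeas)
  have h2 := h _ (measurableSet_le hmeas (measurable_const (a := (0 : ℝ))))
  have h1' := (abs_le.1 h1).2
  have h2' := (abs_le.1 h2).1
  linarith

lemma exists_dominating (s : ℕ → Measure Ω) [∀ n, IsFiniteMeasure (s n)] :
    ∃ ν : Measure Ω, IsFiniteMeasure ν ∧ ∀ n, s n ≪ ν :=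
  ⟨(Measure.sum s).toFinite, inferInstance, fun n =>
    (Measure.absolutelyContinuous_sum_right n Measure.AbsolutelyContinuous.rfl).trans
      (absolutelyContinuous_toFinite _)⟩

/-- The probability measures are complete in total variation: the densities with respect to a
common dominating measure converge in `L¹`. -/
lemma exists_tvClose_limit (c : ℕ → ProbabilityMeasure Ω)
    (hc : ∀ η : ℝ, 0 < η → ∃ N, ∀ n ≥ N, ∀ m ≥ N, TVClose η (c n) (c m)) :
    ∃ q : ProbabilityMeasure Ω, ∀ η : ℝ, 0 < η → ∃ N, ∀ n ≥ N, TVClose η (c n) q := by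
  obtain ⟨ν, hν, hac⟩ := exists_dominating fun n => (c n : Measure Ω)
  have hi : ∀ n, Integrable (fun y => ((c n : Measure Ω).rnDeriv ν y).toReal) ν :=
    fun n => Measure.integrable_toReal_rnDeriv
  have hcau : CauchySeq fun n => (hi n).toL1 := by
    rw [EMetric.cauchySeq_iff]
    intro ε hε
    obtain ⟨δ, hδ, hδε⟩ : ∃ δ : ℝ, 0 < δ ∧ ENNReal.ofReal (2 * δ) < ε := by
      obtain ⟨r, hr0, hr⟩ := ENNReal.lt_iff_exists_nnreal_btwn.1 hε
      refine ⟨r / 2, by have : 0 < r := by exact_mod_cast hr0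
                        positivity, ?_⟩
      rwa [mul_div_cancel₀ _ (two_ne_zero), ENNReal.ofReal_coe_nnreal]
    obtain ⟨N, hN⟩ := hc δ hδ
    refine ⟨N, fun m hm n hn => ?_⟩
    rw [Integrable.edist_toL1_toL1]
    exact ((hN m hm n hn).lintegral_edist_le ν (hac m) (hac n)).trans_lt hδε
  obtain ⟨f, hf⟩ := cauchySeq_tendsto_of_complete hcau
  have hfi : Integrable f ν := L1.integrable_coeFn f
  have hset : ∀ η : ℝ, 0 < η → ∃ N, ∀ n ≥ N, ∀ A : Set Ω,
      |(c n : Measure Ω).real A - ∫ y in A, f y ∂ν| ≤ η := by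
    intro η hη
    obtain ⟨N, hN⟩ := Metric.tendsto_atTop.1 hf η hη
    refine ⟨N, fun n hn A => ?_⟩
    rw [← Measure.setIntegral_toReal_rnDeriv (hac n), ← integral_sub (hi n).integrableOn
      hfi.integrableOn]
    have h1 := hN n hn
    rw [L1.dist_eq_integral_dist] at h1
    calc |∫ y in A, (((c n : Measure Ω).rnDeriv ν y).toReal - f y) ∂ν|
        ≤ ∫ y in A, |((c n : Measure Ω).rnDeriv ν y).toReal - f y| ∂ν :=
          abs_integral_le_integral_abs
      _ ≤ ∫ y, |((c n : Measure Ω).rnDeriv ν y).toReal - f y| ∂ν :=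
          setIntegral_le_integral ((hi n).sub hfi).abs
            (Eventually.of_forall fun _ => abs_nonneg _)
      _ = ∫ y, dist ((hi n).toL1 _ y) (f y) ∂ν := by
          apply integral_congr_ae
          filter_upwards [(hi n).coeFn_toL1] with y hy
          rw [hy, Real.dist_eq]
      _ ≤ η := h1.le
  have hf0 : 0 ≤ᵐ[ν] f := by
    apply ae_nonneg_of_forall_setIntegral_nonneg hfi
    intro A _ _
    apply le_of_forall_pos_le_add
    intro η hη
    obtain ⟨N, hN⟩ := hset η hη
    have h1 := (abs_le.1 (hN N le_rfl A)).2
    have h2 : 0 ≤ (c N : Measure Ω).real A := measureReal_nonneg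
    linarith
  have hreal : ∀ A, MeasurableSet A →
      (ν.withDensity fun y => ENNReal.ofReal (f y)) A = ENNReal.ofReal (∫ y in A, f y ∂ν) := by
    intro A hA
    rw [withDensity_apply _ hA, ofReal_integral_eq_lintegral_ofReal hfi.integrableOn
      (ae_restrict_of_ae hf0)]
  have hprob : IsProbabilityMeasure (ν.withDensity fun y => ENNReal.ofReal (f y)) := by
    constructor
    rw [hreal _ MeasurableSet.univ]
    have : ∫ y in Set.univ, f y ∂ν = 1 := by
      apply eq_of_forall_dist_le
      intro η hη
      obtain ⟨N, hN⟩ := hset η hη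
      have h1 := hN N le_rfl Set.univ
      rwa [probReal_univ, abs_sub_comm] at h1
    rw [this, ENNReal.ofReal_one]
  refine ⟨⟨_, hprob⟩, fun η hη => ?_⟩
  obtain ⟨N, hN⟩ := hset η hη
  refine ⟨N, fun n hn A hA => ?_⟩
  have h1 := hN n hn A
  have h2 : 0 ≤ ∫ y in A, f y ∂ν := setIntegral_nonneg_of_ae hf0
  change |_ - Measure.real (ν.withDensity fun y => ENNReal.ofReal (f y)) A| ≤ η
  rwa [Measure.real, Measure.real, hreal A hA, ENNReal.toReal_ofReal h2]

/-- Along a sequence converging fast enough in total variation, the densities with respect to a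
dominating measure converge almost everywhere. -/
lemma ae_tendsto_rnDeriv {P : ProbabilityMeasure Ω} {p : ℕ → ProbabilityMeasure Ω}
    (hp : ∀ n, TVClose ((1 / 2) ^ n) (p n) P) (ν : Measure Ω) [IsFiniteMeasure ν]
    (hP : (P : Measure Ω) ≪ ν) (hpn : ∀ n, (p n : Measure Ω) ≪ ν) :
    ∀ᵐ y ∂ν, Tendsto (fun n => (p n : Measure Ω).rnDeriv ν y) atTop
      (𝓝 ((P : Measure Ω).rnDeriv ν y)) := by
  have hm : ∀ n, Measurable fun y => edist ((p n : Measure Ω).rnDeriv ν y).toReal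
      ((P : Measure Ω).rnDeriv ν y).toReal := fun n =>
    (Measure.measurable_rnDeriv _ _).ennreal_toReal.edist
      (Measure.measurable_rnDeriv _ _).ennreal_toReal
  have hsum : ∫⁻ y, ∑' n, edist ((p n : Measure Ω).rnDeriv ν y).toReal
      ((P : Measure Ω).rnDeriv ν y).toReal ∂ν ≠ ∞ := by
    rw [lintegral_tsum fun n => (hm n).aemeasurable]
    refine ne_top_of_le_ne_top ?_
      (ENNReal.tsum_le_tsum fun n => (hp n).lintegral_edist_le ν (hpn n) hP)
    have hs : Summable fun n : ℕ => 2 * (1 / 2 : ℝ) ^ n := summable_geometric_two.mul_left 2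
    exact hs.tsum_ofReal_ne_top
  have hae := ae_lt_top (Measurable.tsum hm) hsum
  have hfin : ∀ᵐ y ∂ν, ∀ n, (p n : Measure Ω).rnDeriv ν y ≠ ∞ :=
    ae_all_iff.2 fun n => Measure.rnDeriv_ne_top _ _
  filter_upwards [hae, hfin, Measure.rnDeriv_ne_top (P : Measure Ω) ν] with y hy hn hPy
  have h0 := ENNReal.tendsto_atTop_zero_of_tsum_ne_top hy.ne
  have h1 : Tendsto (fun n => ((p n : Measure Ω).rnDeriv ν y).toReal) atTop
      (𝓝 ((P : Measure Ω).rnDeriv ν y).toReal) := tendsto_iff_edist_tendsto_0.2 h0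
  have h2 := ENNReal.tendsto_ofReal h1
  simpa only [ENNReal.ofReal_toReal (hn _), ENNReal.ofReal_toReal hPy] using h2

/-! ### The capacity argument for an abstract divergence -/

/-- The part of the argument that does not depend on the order. A divergence `D` and an information
functional `I` are given, with a center `c p` attached to every prior. `hS` is the consequence
of Sibson's identity for one prior, while `hM` and `hW` are its consequences for mixtures of a
nearly optimal prior with another nearly optimal one, or with a point mass. `hP` is an inequality
of Pinsker type and `hL` is lower semicontinuity, both for the total variation distance. -/
theorem center_of_sibson {D : ProbabilityMeasure Ω → ProbabilityMeasure Ω → EReal}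
    {I : (ProbabilityMeasure Ω →₀ ℝ≥0) → EReal} {𝒲 : Set (ProbabilityMeasure Ω)}
    {c : (ProbabilityMeasure Ω →₀ ℝ≥0) → ProbabilityMeasure Ω} {C : ℝ}
    (hne : (priors 𝒲).Nonempty)
    (hC : (⨆ p ∈ priors 𝒲, I p) = (C : EReal))
    (hD0 : ∀ P Q, 0 ≤ D P Q)
    (hS : ∀ p ∈ priors 𝒲, ∀ Q, I p + D (c p) Q ≤ ⨆ W ∈ 𝒲, D W Q)
    (hM : ∀ δ : ℝ, 0 < δ → ∃ ε : ℝ, 0 < ε ∧ ∀ p ∈ priors 𝒲, ∀ p' ∈ priors 𝒲,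
      ((C - ε : ℝ) : EReal) ≤ I p → ((C - ε : ℝ) : EReal) ≤ I p' →
      ∃ Q, D (c p) Q ≤ δ ∧ D (c p') Q ≤ δ)
    (hW : ∀ δ : ℝ, 0 < δ → ∃ ε : ℝ, 0 < ε ∧ ∀ p ∈ priors 𝒲, ∀ W ∈ 𝒲,
      ((C - ε : ℝ) : EReal) ≤ I p → ∃ Q, D W Q ≤ ((C + δ : ℝ) : EReal) ∧ D (c p) Q ≤ δ)
    (hP : ∀ η : ℝ, 0 < η → ∃ δ : ℝ, 0 < δ ∧ ∀ P Q, D P Q ≤ δ → TVClose η P Q)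
    (hL : ∀ P Q, ∀ r : ℝ, 0 ≤ r → (∀ η : ℝ, 0 < η → ∃ P' Q', TVClose η P' P ∧ TVClose η Q' Q ∧
      D P' Q' ≤ r) → D P Q ≤ r) :
    (C : EReal) = (⨅ Q, ⨆ W ∈ 𝒲, D W Q) ∧
    (∃! q, (C : EReal) = ⨆ W ∈ 𝒲, D W q) ∧
    ∀ q, (C : EReal) = (⨆ W ∈ 𝒲, D W q) → ∀ Q, (C : EReal) + D q Q ≤ ⨆ W ∈ 𝒲, D W Q := by
  have hle : ∀ Q, (C : EReal) ≤ ⨆ W ∈ 𝒲, D W Q := by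
    intro Q
    rw [← hC]
    refine iSup₂_le fun p hp => le_trans ?_ (hS p hp Q)
    exact le_add_of_nonneg_right (hD0 _ _)
  have hnear : ∀ ε : ℝ, 0 < ε → ∃ p ∈ priors 𝒲, ((C - ε : ℝ) : EReal) ≤ I p := by
    intro ε hε
    have h1 : ((C - ε : ℝ) : EReal) < ⨆ p ∈ priors 𝒲, I p := by
      rw [hC]
      exact_mod_cast sub_lt_self C hε
    obtain ⟨p, hp⟩ := lt_iSup_iff.1 h1
    obtain ⟨hp1, hp2⟩ := lt_iSup_iff.1 hp
    exact ⟨p, hp1, hp2.le⟩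
  have hC0 : 0 ≤ C := by
    obtain ⟨p, hp⟩ := hne
    by_contra! hneg
    obtain ⟨W, hWW⟩ : 𝒲.Nonempty := by
      by_contra hemp
      rw [Set.not_nonempty_iff_eq_empty] at hemp
      have := hp.2
      have hs := hp.1
      rw [hemp, Set.subset_empty_iff, Finset.coe_eq_empty] at hs
      rw [hs] at this
      simp at this
    obtain ⟨ε, hε, h⟩ := hW (-C / 2) (by linarith)
    obtain ⟨p, hp, hpI⟩ := hnear ε hε
    obtain ⟨Q, hQ, _⟩ := h p hp W hWW hpI
    have h3 := (hD0 W Q).trans hQ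
    have h4 : (0 : ℝ) ≤ C + -C / 2 := by exact_mod_cast h3
    linarith
  -- near optimal priors have close centers
  have hclose : ∀ η : ℝ, 0 < η → ∃ ε : ℝ, 0 < ε ∧ ∀ p ∈ priors 𝒲, ∀ p' ∈ priors 𝒲,
      ((C - ε : ℝ) : EReal) ≤ I p → ((C - ε : ℝ) : EReal) ≤ I p' → TVClose η (c p) (c p') := by
    intro η hη
    obtain ⟨δ, hδ, hδP⟩ := hP (η / 2) (half_pos hη)
    obtain ⟨ε, hε, h⟩ := hM δ hδ
    refine ⟨ε, hε, fun p hp p' hp' hI hI' => ?_⟩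
    obtain ⟨Q, h1, h2⟩ := h p hp p' hp' hI hI'
    exact ((hδP _ _ h1).trans (hδP _ _ h2).symm).mono (by linarith)
  choose p hp hpI using fun n : ℕ => hnear (1 / ((n : ℝ) + 1)) (by positivity)
  have hpε : ∀ ε : ℝ, 0 < ε → ∃ N, ∀ n ≥ N, ((C - ε : ℝ) : EReal) ≤ I (p n) := by
    intro ε hε
    obtain ⟨N, hN⟩ := exists_nat_one_div_lt hε
    refine ⟨N, fun n hn => le_trans ?_ (hpI n)⟩
    have h1 : 1 / ((n : ℝ) + 1) ≤ 1 / ((N : ℝ) + 1) := by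
      have : (N : ℝ) ≤ n := by exact_mod_cast hn
      gcongr
    exact_mod_cast (by linarith : C - ε ≤ C - 1 / ((n : ℝ) + 1))
  obtain ⟨q, hq⟩ := exists_tvClose_limit (fun n => c (p n)) fun η hη => by
    obtain ⟨ε, hε, h⟩ := hclose η hη
    obtain ⟨N, hN⟩ := hpε ε hε
    exact ⟨N, fun n hn m hm => h _ (hp n) _ (hp m) (hN n hn) (hN m hm)⟩
  have hqC : ∀ W ∈ 𝒲, D W q ≤ C := by
    intro W hWW
    refine EReal.le_of_forall_lt_iff_le.1 fun r hr => ?_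
    have hr' : C < r := by exact_mod_cast hr
    refine hL W q r (hC0.trans hr'.le) fun η hη => ?_
    obtain ⟨δ, hδ, hδP⟩ := hP (η / 2) (half_pos hη)
    obtain ⟨ε, hε, h⟩ := hW (min δ (r - C)) (lt_min hδ (by linarith))
    obtain ⟨N, hN⟩ := hpε ε hε
    obtain ⟨N', hN'⟩ := hq (η / 2) (half_pos hη)
    obtain ⟨Q, h1, h2⟩ := h _ (hp (max N N')) W hWW (hN _ (le_max_left _ _))
    refine ⟨W, Q, (TVClose.refl W).mono hη.le, ?_, h1.trans ?_⟩
    · have h3 := hδP _ _ (h2.trans (by exact_mod_cast min_le_left _ _))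
      exact (h3.symm.trans (hN' _ (le_max_right _ _))).mono (by linarith)
    · have := min_le_right δ (r - C)
      exact_mod_cast (by linarith : C + min δ (r - C) ≤ r)
  have hqeq : (C : EReal) = ⨆ W ∈ 𝒲, D W q := le_antisymm (hle q) (iSup₂_le hqC)
  have hvEH : ∀ Q, (C : EReal) + D q Q ≤ ⨆ W ∈ 𝒲, D W Q := by
    intro Q
    have hLC := hle Q
    induction hLL : (⨆ W ∈ 𝒲, D W Q) with
    | bot => rw [hLL] at hLC; simp at hLC
    | top => exact le_top
    | coe L =>
      rw [hLL] at hLC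
      have hLC' : C ≤ L := by exact_mod_cast hLC
      have hd : D q Q ≤ ((L - C : ℝ) : EReal) := by
        refine EReal.le_of_forall_lt_iff_le.1 fun r hr => ?_
        have hr' : L - C < r := by exact_mod_cast hr
        refine hL q Q r (by linarith) fun η hη => ?_
        obtain ⟨N, hN⟩ := hpε (r - (L - C)) (by linarith)
        obtain ⟨N', hN'⟩ := hq η hη
        set n := max N N'
        refine ⟨c (p n), Q, hN' _ (le_max_right _ _), (TVClose.refl Q).mono hη.le, ?_⟩
        have h1 := hS (p n) (hp n) Q
        rw [hLL] at h1
        have h2 := hN n (le_max_left _ _)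
        have h3 := (add_le_add_left h2 (D (c (p n)) Q)).trans h1
        have h4 := hD0 (c (p n)) Q
        induction hx : D (c (p n)) Q with
        | bot => exact bot_le
        | top => rw [hx, EReal.coe_add_top] at h3; simp at h3
        | coe x =>
          rw [hx] at h3
          have h5 : C - (r - (L - C)) + x ≤ L := by exact_mod_cast h3
          exact_mod_cast (by linarith : x ≤ r)
      calc (C : EReal) + D q Q ≤ (C : EReal) + ((L - C : ℝ) : EReal) := by gcongr
        _ = L := by rw [← EReal.coe_add]; congr 1; ring
  have huniq : ∀ q', (C : EReal) = (⨆ W ∈ 𝒲, D W q') → q' = q := by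
    intro q' hq'
    have h1 := hvEH q'
    rw [← hq'] at h1
    have h2 : D q q' ≤ 0 := by
      have h4 := hD0 q q'
      induction hx : D q q' with
      | bot => exact bot_le
      | top => rw [hx] at h1; simp at h1
      | coe x =>
        rw [hx] at h1
        have h5 : C + x ≤ C := by exact_mod_cast h1
        exact_mod_cast (by linarith : x ≤ 0)
    apply Subtype.ext
    apply Measure.ext
    intro A hA
    have h3 : (q : Measure Ω).real A = (q' : Measure Ω).real A := by
      apply eq_of_forall_dist_le
      intro η hη
      obtain ⟨δ, hδ, hδP⟩ := hP η hη
      exact hδP _ _ (h2.trans (by exact_mod_cast hδ.le)) A hA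
    exact ((measureReal_eq_measureReal_iff).1 h3).symm
  refine ⟨le_antisymm (le_iInf hle) (iInf_le_of_le q hqeq.ge), ⟨q, hqeq, huniq⟩, ?_⟩
  intro q' hq'
  rw [huniq q' hq']
  exact hvEH

/-! ### The integrand of the divergences of finite order -/

/-- The integrand of the order `a` divergence, normalized so as to be nonnegative, to be homogeneous
of degree one and to vanish on the diagonal. Up to a factor `|a - 1|` when `a ≠ 1`, it is the
perspective of the convex function generating the Hellinger divergence of order `a`. -/
noncomputable def kernel (a : ℝ) (x y : ℝ≥0∞) : ℝ≥0∞ :=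
  if a < 1 then ENNReal.ofReal a * x + ENNReal.ofReal (1 - a) * y - x ^ a * y ^ (1 - a)
  else if a = 1 then
    if y = 0 then (if x = 0 then 0 else ∞)
    else y * ENNReal.ofReal (InformationTheory.klFun (x / y).toReal)
  else x ^ a * y ^ (1 - a) + ENNReal.ofReal (a - 1) * y - ENNReal.ofReal a * x

lemma kernel_of_lt_one {a : ℝ} (ha : a < 1) (x y : ℝ≥0∞) :
    kernel a x y = ENNReal.ofReal a * x + ENNReal.ofReal (1 - a) * y - x ^ a * y ^ (1 - a) :=
  if_pos ha

lemma kernel_of_one_lt {a : ℝ} (ha : 1 < a) (x y : ℝ≥0∞) :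
    kernel a x y = x ^ a * y ^ (1 - a) + ENNReal.ofReal (a - 1) * y - ENNReal.ofReal a * x := by
  rw [kernel, if_neg ha.not_gt, if_neg ha.ne']

lemma kernel_one (x y : ℝ≥0∞) :
    kernel 1 x y = if y = 0 then (if x = 0 then 0 else ∞)
      else y * ENNReal.ofReal (InformationTheory.klFun (x / y).toReal) := by
  rw [kernel, if_neg (lt_irrefl _), if_pos rfl]

lemma measurable_kernel (a : ℝ) : Measurable fun z : ℝ≥0∞ × ℝ≥0∞ => kernel a z.1 z.2 := by
  rcases lt_trichotomy a 1 with ha | rfl | ha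
  · simp only [kernel_of_lt_one ha]
    fun_prop
  · simp only [kernel_one]
    refine Measurable.ite (measurable_snd (measurableSet_singleton 0))
      (Measurable.ite (measurable_fst (measurableSet_singleton 0)) measurable_const
        measurable_const) ?_
    exact measurable_snd.mul (ENNReal.measurable_ofReal.comp
      (InformationTheory.measurable_klFun.comp (by fun_prop)))
  · simp only [kernel_of_one_lt ha]
    fun_prop

lemma rpow_mul_rpow_one_sub_mul {a : ℝ} (ha : 0 < a) {x y r : ℝ≥0∞} (hx : x ≠ ∞) (hy : y ≠ ∞)
    (hr : r ≠ ∞) : (x * r) ^ a * (y * r) ^ (1 - a) = x ^ a * y ^ (1 - a) * r := by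
  rcases eq_or_ne r 0 with rfl | hr0
  · simp [ENNReal.zero_rpow_of_pos ha]
  · rw [ENNReal.mul_rpow_of_ne_top hx hr, ENNReal.mul_rpow_of_ne_top hy hr]
    calc x ^ a * r ^ a * (y ^ (1 - a) * r ^ (1 - a))
        = x ^ a * y ^ (1 - a) * (r ^ a * r ^ (1 - a)) := by ring
      _ = x ^ a * y ^ (1 - a) * r := by
        rw [← ENNReal.rpow_add _ _ hr0 hr]; simp

/-- The kernel is homogeneous of degree one. -/
lemma kernel_mul {a : ℝ} (ha : 0 < a) {x y r : ℝ≥0∞} (hx : x ≠ ∞) (hy : y ≠ ∞) (hr : r ≠ ∞) :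
    kernel a (x * r) (y * r) = kernel a x y * r := by
  rcases lt_trichotomy a 1 with h1 | rfl | h1
  · rw [kernel_of_lt_one h1, kernel_of_lt_one h1, rpow_mul_rpow_one_sub_mul ha hx hy hr,
      ENNReal.sub_mul fun _ _ => hr, add_mul]
    simp only [mul_assoc]
  · rw [kernel_one, kernel_one]
    rcases eq_or_ne r 0 with rfl | hr0
    · simp
    · by_cases hy0 : y = 0
      · by_cases hx0 : x = 0 <;> simp [hy0, hx0, hr0]
      · rw [if_neg hy0, if_neg (mul_ne_zero hy0 hr0), ENNReal.mul_div_mul_right _ _ hr0 hr]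
        ring
  · rw [kernel_of_one_lt h1, kernel_of_one_lt h1, rpow_mul_rpow_one_sub_mul ha hx hy hr,
      ENNReal.sub_mul fun _ _ => hr, add_mul]
    simp only [mul_assoc]

lemma rpow_mul_rpow_one_sub_self {a : ℝ} (ha : 0 < a) {x : ℝ≥0∞} (hx : x ≠ ∞) :
    x ^ a * x ^ (1 - a) = x := by
  simpa using rpow_mul_rpow_one_sub_mul ha ENNReal.one_ne_top ENNReal.one_ne_top hx

lemma kernel_self {a : ℝ} (ha : 0 < a) {x : ℝ≥0∞} (hx : x ≠ ∞) : kernel a x x = 0 := by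
  rcases lt_trichotomy a 1 with h1 | rfl | h1
  · rw [kernel_of_lt_one h1, rpow_mul_rpow_one_sub_self ha hx, ← add_mul,
      ← ENNReal.ofReal_add ha.le (by linarith)]
    simp
  · rw [kernel_one]
    split_ifs with h0
    · rfl
    · rw [ENNReal.div_self h0 hx]
      simp [InformationTheory.klFun_one]
  · rw [kernel_of_one_lt h1, rpow_mul_rpow_one_sub_self ha hx]
    have : x + ENNReal.ofReal (a - 1) * x = ENNReal.ofReal a * x := by
      rw [← one_add_mul, ← ENNReal.ofReal_one, ← ENNReal.ofReal_add zero_le_one (by linarith)]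
      congr 2; ring
    rw [this, tsub_self]

/-! ### Weighted means and the Hellinger distance -/

/-- The squared Hellinger distance bounds the kernel from below, for orders below one: this is
Young's inequality with the term `2 √x √y` split off. -/
lemma hellinger_le_of_lt_one {a x y : ℝ} (ha : 0 < a) (ha1 : a < 1) (hx : 0 ≤ x) (hy : 0 ≤ y) :
    min a (1 - a) * (x + y - 2 * (√x * √y)) ≤ a * x + (1 - a) * y - x ^ a * y ^ (1 - a) := by
  -- the case `a ≤ 1 / 2`; the other one follows by exchanging `x` and `y`
  have key : ∀ b : ℝ, 0 < b → b ≤ 1 / 2 → ∀ u v : ℝ, 0 ≤ u → 0 ≤ v →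
      b * (u + v - 2 * (√u * √v)) ≤ b * u + (1 - b) * v - u ^ b * v ^ (1 - b) := by
    intro b hb hb2 u v hu hv
    have h := Real.geom_mean_le_arith_mean2_weighted (w₁ := 2 * b) (w₂ := 1 - 2 * b)
      (p₁ := √u * √v) (p₂ := v) (by positivity) (by linarith) (by positivity) hv (by ring)
    have h2 : (√u * √v) ^ (2 * b) * v ^ (1 - 2 * b) = u ^ b * v ^ (1 - b) := by
      rw [← Real.sqrt_mul hu, Real.sqrt_eq_rpow, ← Real.rpow_mul (by positivity),
        Real.mul_rpow hu hv]
      rw [show 1 / 2 * (2 * b) = b by ring, mul_assoc]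
      congr 1
      rw [← Real.rpow_add_of_nonneg hv (by linarith) (by linarith)]
      congr 1; ring
    rw [h2] at h
    linarith
  rcases le_total a (1 / 2) with h | h
  · rw [min_eq_left (by linarith)]
    exact key a ha h x y hx hy
  · rw [min_eq_right (by linarith)]
    have h1 := key (1 - a) (by linarith) (by linarith) y x hy hx
    rw [show 1 - (1 - a) = a by ring, mul_comm (√y) (√x), mul_comm (y ^ (1 - a))] at h1
    linarith

lemma hellinger_le_of_one_lt {a x y : ℝ} (ha1 : 1 < a) (hx : 0 ≤ x) (hy : 0 < y) :
    (a - 1) * (x + y - 2 * (√x * √y)) ≤ x ^ a * y ^ (1 - a) + (a - 1) * y - a * x := by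
  have hd : 0 < 2 * a - 1 := by linarith
  have hd' := hd.ne'
  have h := Real.geom_mean_le_arith_mean2_weighted (w₁ := 1 / (2 * a - 1))
    (w₂ := (2 * a - 2) / (2 * a - 1)) (p₁ := x ^ a * y ^ (1 - a)) (p₂ := √x * √y)
    (by positivity) (div_nonneg (by linarith) hd.le) (by positivity) (by positivity)
    (by field_simp; ring)
  have h2 : (x ^ a * y ^ (1 - a)) ^ (1 / (2 * a - 1)) * (√x * √y) ^ ((2 * a - 2) / (2 * a - 1))
      = x := by
    rw [← Real.sqrt_mul hx, Real.sqrt_eq_rpow, Real.mul_rpow (by positivity) (by positivity),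
      ← Real.rpow_mul (by positivity), ← Real.rpow_mul (by positivity),
      ← Real.rpow_mul (by positivity), Real.mul_rpow hx hy.le, mul_mul_mul_comm,
      ← Real.rpow_add hy, ← Real.rpow_add_of_nonneg hx (by positivity)
        (mul_nonneg (by norm_num) (div_nonneg (by linarith) hd.le)),
      show a * (1 / (2 * a - 1)) + 1 / 2 * ((2 * a - 2) / (2 * a - 1)) = (2 * a - 1) / (2 * a - 1)
        by ring, div_self hd',
      show (1 - a) * (1 / (2 * a - 1)) + 1 / 2 * ((2 * a - 2) / (2 * a - 1)) = 0 by
        field_simp; ring]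
    simp
  rw [h2] at h
  have h3 : (2 * a - 1) * x ≤ x ^ a * y ^ (1 - a) + (2 * a - 2) * (√x * √y) := by
    calc (2 * a - 1) * x ≤ (2 * a - 1) * (1 / (2 * a - 1) * (x ^ a * y ^ (1 - a))
          + (2 * a - 2) / (2 * a - 1) * (√x * √y)) := by gcongr
      _ = _ := by field_simp
  linarith

lemma hellinger_le_klFun {x y : ℝ} (hx : 0 ≤ x) (hy : 0 < y) :
    x + y - 2 * (√x * √y) ≤ y * InformationTheory.klFun (x / y) := by
  rw [InformationTheory.klFun_apply]
  have h0 : y * (x / y * Real.log (x / y) + 1 - x / y) = x * Real.log (x / y) + y - x := by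
    field_simp
  rw [h0]
  rcases hx.eq_or_lt with rfl | hx
  · simp
  have h1 := Real.log_le_sub_one_of_pos (x := √y / √x) (by positivity)
  rw [Real.log_div (by positivity) (by positivity), Real.log_sqrt hy.le, Real.log_sqrt hx.le] at h1
  rw [Real.log_div hx.ne' hy.ne']
  have h2 : x * (√y / √x) = √x * √y := by
    nth_rewrite 1 [← Real.mul_self_sqrt hx.le]
    field_simp
  nlinarith [mul_le_mul_of_nonneg_left h1 hx.le]

lemma le_add_hellinger {x y s : ℝ} (hs : 0 < s) (hx : 0 ≤ x) (hy : 0 ≤ y) :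
    x ≤ y + s * (x + y) + 1 / (2 * s) * (x + y - 2 * (√x * √y)) := by
  obtain ⟨u, hu⟩ : ∃ u, u = √x := ⟨_, rfl⟩
  obtain ⟨v, hv⟩ : ∃ v, v = √y := ⟨_, rfl⟩
  have hxu : x = u ^ 2 := by rw [hu, Real.sq_sqrt hx]
  have hyv : y = v ^ 2 := by rw [hv, Real.sq_sqrt hy]
  rw [← hu, ← hv, hxu, hyv]
  have h : v ^ 2 + s * (u ^ 2 + v ^ 2) + 1 / (2 * s) * (u ^ 2 + v ^ 2 - 2 * (u * v)) - u ^ 2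
      = 1 / (2 * s) * ((u - v) - s * (u + v)) ^ 2 + s / 2 * (u - v) ^ 2 := by
    field_simp
    ring
  have h2 : 0 ≤ 1 / (2 * s) * ((u - v) - s * (u + v)) ^ 2 + s / 2 * (u - v) ^ 2 := by positivity
  linarith

lemma rpow_mul_rpow_le {a : ℝ} (ha : 0 < a) (ha1 : a < 1) {x y : ℝ≥0∞} (hx : x ≠ ∞)
    (hy : y ≠ ∞) :
    x ^ a * y ^ (1 - a) ≤ ENNReal.ofReal a * x + ENNReal.ofReal (1 - a) * y := by
  rw [← ENNReal.ofReal_toReal hx, ← ENNReal.ofReal_toReal hy,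
    ENNReal.ofReal_rpow_of_nonneg ENNReal.toReal_nonneg ha.le,
    ENNReal.ofReal_rpow_of_nonneg ENNReal.toReal_nonneg (by linarith),
    ← ENNReal.ofReal_mul (by positivity), ← ENNReal.ofReal_mul (by positivity),
    ← ENNReal.ofReal_mul (by linarith), ← ENNReal.ofReal_add (by positivity)
      (mul_nonneg (by linarith) ENNReal.toReal_nonneg)]
  exact ENNReal.ofReal_le_ofReal (Real.geom_mean_le_arith_mean2_weighted ha.le (by linarith)
    ENNReal.toReal_nonneg ENNReal.toReal_nonneg (by ring))

lemma kernel_add_rpow {a : ℝ} (ha : 0 < a) (ha1 : a < 1) {x y : ℝ≥0∞} (hx : x ≠ ∞) (hy : y ≠ ∞) :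
    kernel a x y + x ^ a * y ^ (1 - a) = ENNReal.ofReal a * x + ENNReal.ofReal (1 - a) * y := by
  rw [kernel_of_lt_one ha1]
  exact tsub_add_cancel_of_le (rpow_mul_rpow_le ha ha1 hx hy)

lemma kernel_zero_right {a : ℝ} (ha1 : 1 ≤ a) {x : ℝ≥0∞} (hx : x ≠ 0) (hx' : x ≠ ∞) :
    kernel a x 0 = ∞ := by
  rcases ha1.eq_or_lt with rfl | ha1
  · simp [kernel_one, hx]
  · rw [kernel_of_one_lt ha1, ENNReal.zero_rpow_of_neg (by linarith),
      ENNReal.mul_top (ENNReal.rpow_pos (pos_iff_ne_zero.2 hx) hx').ne', top_add,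
      ENNReal.top_sub (ENNReal.mul_ne_top ENNReal.ofReal_ne_top hx')]

lemma kernel_add_mul {a : ℝ} (ha1 : 1 < a) {x y : ℝ≥0∞} (hx : x ≠ ∞) (hy : y ≠ ∞) :
    kernel a x y + ENNReal.ofReal a * x = x ^ a * y ^ (1 - a) + ENNReal.ofReal (a - 1) * y := by
  rw [kernel_of_one_lt ha1]
  refine tsub_add_cancel_of_le ?_
  rcases eq_or_ne y 0 with rfl | hy0
  · rcases eq_or_ne x 0 with rfl | hx0
    · simp
    · rw [ENNReal.zero_rpow_of_neg (by linarith),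
        ENNReal.mul_top (ENNReal.rpow_pos (pos_iff_ne_zero.2 hx0) hx).ne', top_add]
      exact le_top
  · have hyp : 0 < y.toReal := ENNReal.toReal_pos hy0 hy
    have h := hellinger_le_of_one_lt ha1 (x := x.toReal) ENNReal.toReal_nonneg hyp
    have h2 : 0 ≤ x.toReal + y.toReal - 2 * (√x.toReal * √y.toReal) := by
      nlinarith [sq_nonneg (√x.toReal - √y.toReal), Real.sq_sqrt (ENNReal.toReal_nonneg (a := x)),
        Real.sq_sqrt hyp.le]
    have h3 := mul_nonneg (by linarith : 0 ≤ a - 1) h2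
    rw [← ENNReal.ofReal_toReal hx, ← ENNReal.ofReal_toReal hy,
      ENNReal.ofReal_rpow_of_nonneg ENNReal.toReal_nonneg (by linarith),
      ENNReal.ofReal_rpow_of_pos hyp,
      ← ENNReal.ofReal_mul (by linarith), ← ENNReal.ofReal_mul (by positivity),
      ← ENNReal.ofReal_mul (by linarith), ← ENNReal.ofReal_add (by positivity)
        (mul_nonneg (by linarith) ENNReal.toReal_nonneg)]
    exact ENNReal.ofReal_le_ofReal (by linarith)

/-- The kernel dominates a multiple of the squared Hellinger distance. -/
lemma exists_hellinger_le_kernel {a : ℝ} (ha : 0 < a) : ∃ k : ℝ, 0 < k ∧ ∀ x y : ℝ, 0 ≤ x → 0 ≤ y →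
    ENNReal.ofReal (k * (x + y - 2 * (√x * √y)))
      ≤ kernel a (ENNReal.ofReal x) (ENNReal.ofReal y) := by
  have htop : ∀ k x : ℝ, 1 ≤ a → 0 ≤ x → ENNReal.ofReal (k * (x + 0 - 2 * (√x * √0)))
      ≤ kernel a (ENNReal.ofReal x) (ENNReal.ofReal 0) := by
    intro k x ha1 hx
    rcases hx.eq_or_lt with rfl | hx
    · simp
    · rw [ENNReal.ofReal_zero, kernel_zero_right ha1 (by simpa using hx) ENNReal.ofReal_ne_top]
      exact le_top
  rcases lt_trichotomy a 1 with h1 | rfl | h1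
  · refine ⟨min a (1 - a), lt_min ha (by linarith), fun x y hx hy => ?_⟩
    rw [kernel_of_lt_one h1, ENNReal.ofReal_rpow_of_nonneg hx ha.le,
      ENNReal.ofReal_rpow_of_nonneg hy (by linarith), ← ENNReal.ofReal_mul ha.le,
      ← ENNReal.ofReal_mul (by linarith), ← ENNReal.ofReal_mul (by positivity),
      ← ENNReal.ofReal_add (by positivity) (mul_nonneg (by linarith) hy),
      ← ENNReal.ofReal_sub _ (by positivity)]
    exact ENNReal.ofReal_le_ofReal (hellinger_le_of_lt_one ha h1 hx hy)
  · refine ⟨1, one_pos, fun x y hx hy => ?_⟩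
    rcases hy.eq_or_lt with rfl | hy
    · exact htop _ x le_rfl hx
    rw [kernel_one, if_neg (by simpa using hy), ← ENNReal.ofReal_div_of_pos hy,
      ENNReal.toReal_ofReal (by positivity), ← ENNReal.ofReal_mul hy.le, one_mul]
    exact ENNReal.ofReal_le_ofReal (hellinger_le_klFun hx hy)
  · refine ⟨a - 1, by linarith, fun x y hx hy => ?_⟩
    rcases hy.eq_or_lt with rfl | hy
    · exact htop _ x h1.le hx
    rw [kernel_of_one_lt h1, ENNReal.ofReal_rpow_of_nonneg hx ha.le,
      ENNReal.ofReal_rpow_of_pos hy, ← ENNReal.ofReal_mul (by positivity),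
      ← ENNReal.ofReal_mul (by linarith), ← ENNReal.ofReal_mul (by linarith),
      ← ENNReal.ofReal_add (by positivity) (mul_nonneg (by linarith) hy.le),
      ← ENNReal.ofReal_sub _ (by positivity)]
    exact ENNReal.ofReal_le_ofReal (hellinger_le_of_one_lt h1 hx hy)

/-- The pointwise inequality behind the bound of Pinsker type. -/
lemma exists_le_add_kernel {a : ℝ} (ha : 0 < a) {s : ℝ} (hs : 0 < s) :
    ∃ k : ℝ, 0 < k ∧ ∀ x y : ℝ≥0∞, x ≠ ∞ → y ≠ ∞ →
      x ≤ y + ENNReal.ofReal s * (x + y) + ENNReal.ofReal k * kernel a x y := by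
  obtain ⟨k, hk, h⟩ := exists_hellinger_le_kernel ha
  refine ⟨1 / (2 * s) / k, by positivity, fun x y hx hy => ?_⟩
  have h1 := h x.toReal y.toReal ENNReal.toReal_nonneg ENNReal.toReal_nonneg
  rw [ENNReal.ofReal_toReal hx, ENNReal.ofReal_toReal hy] at h1
  have h2 := le_add_hellinger hs (ENNReal.toReal_nonneg (a := x)) (ENNReal.toReal_nonneg (a := y))
  calc x = ENNReal.ofReal x.toReal := (ENNReal.ofReal_toReal hx).symm
    _ ≤ ENNReal.ofReal (y.toReal + s * (x.toReal + y.toReal)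
        + 1 / (2 * s) / k * (k * (x.toReal + y.toReal - 2 * (√x.toReal * √y.toReal)))) := by
      apply ENNReal.ofReal_le_ofReal
      refine h2.trans (le_of_eq ?_)
      field_simp
    _ ≤ ENNReal.ofReal (y.toReal + s * (x.toReal + y.toReal)) + ENNReal.ofReal (1 / (2 * s) / k)
        * ENNReal.ofReal (k * (x.toReal + y.toReal - 2 * (√x.toReal * √y.toReal))) := by
      rw [← ENNReal.ofReal_mul (by positivity)]
      exact ENNReal.ofReal_add_le
    _ ≤ _ := by
      rw [ENNReal.ofReal_add ENNReal.toReal_nonneg (by positivity), ENNReal.ofReal_mul hs.le,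
        ENNReal.ofReal_add ENNReal.toReal_nonneg ENNReal.toReal_nonneg, ENNReal.ofReal_toReal hx,
        ENNReal.ofReal_toReal hy]
      gcongr

/-! ### Lower semicontinuity of the integrand -/

/-- The tangent lines of `u ↦ u log u` bound the order one kernel from below. -/
lemma mul_le_kernel_one_add (t : ℝ) {x y : ℝ≥0∞} (hx : x ≠ ∞) (hy : y ≠ ∞) :
    ENNReal.ofReal t * x ≤ kernel 1 x y + ENNReal.ofReal (Real.exp t) * y := by
  rw [kernel_one]
  split_ifs with h0 h1
  · simp [h1]
  · simp
  have hyp : 0 < y.toReal := ENNReal.toReal_pos h0 hy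
  rw [← ENNReal.ofReal_toReal hx, ← ENNReal.ofReal_toReal hy, ← ENNReal.ofReal_div_of_pos hyp,
    ENNReal.toReal_ofReal (by positivity), ← ENNReal.ofReal_mul hyp.le,
    ← ENNReal.ofReal_mul (Real.exp_pos t).le, ← ENNReal.ofReal_mul' ENNReal.toReal_nonneg,
    ← ENNReal.ofReal_add (mul_nonneg hyp.le (InformationTheory.klFun_nonneg (by positivity)))
      (by positivity)]
  apply ENNReal.ofReal_le_ofReal
  set u := x.toReal / y.toReal with hu
  have hxu : x.toReal = u * y.toReal := by rw [hu]; field_simp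
  have hu0 : 0 ≤ u := by positivity
  have h2 := InformationTheory.klFun_nonneg (x := u * Real.exp (-t)) (by positivity)
  rw [InformationTheory.klFun_apply] at h2 ⊢
  have h3 : t * u ≤ u * Real.log u + 1 - u + Real.exp t := by
    rcases hu0.eq_or_lt with h | hupos
    · rw [← h]
      simp only [mul_zero, Real.log_zero, zero_add, sub_zero]
      positivity
    rw [Real.log_mul hupos.ne' (Real.exp_pos _).ne', Real.log_exp] at h2
    have h4 : Real.exp (-t) * Real.exp t = 1 := by rw [← Real.exp_add]; simp
    have h5 := mul_nonneg h2 (Real.exp_pos t).le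
    have h6 : (u * Real.exp (-t) * (Real.log u + -t) + 1 - u * Real.exp (-t)) * Real.exp t
        = u * (Real.log u - t) * (Real.exp (-t) * Real.exp t) + Real.exp t
          - u * (Real.exp (-t) * Real.exp t) := by ring
    rw [h6, h4] at h5
    linarith
  rw [hxu]
  nlinarith [mul_le_mul_of_nonneg_right h3 hyp.le]

lemma kernel_le_liminf {a : ℝ} (ha : 0 < a) {x y : ℝ≥0∞} (hx : x ≠ ∞) (hy : y ≠ ∞)
    {u v : ℕ → ℝ≥0∞} (hu : Tendsto u atTop (𝓝 x)) (hv : Tendsto v atTop (𝓝 y))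
    (hu' : ∀ n, u n ≠ ∞) (hv' : ∀ n, v n ≠ ∞) :
    kernel a x y ≤ liminf (fun n => kernel a (u n) (v n)) atTop := by
  by_cases h00 : x = 0 ∧ y = 0
  · rw [h00.1, h00.2, kernel_self ha ENNReal.zero_ne_top]
    exact zero_le
  have hpow : ∀ {w : ℕ → ℝ≥0∞} {z : ℝ≥0∞} (b : ℝ), Tendsto w atTop (𝓝 z) →
      Tendsto (fun n => w n ^ b) atTop (𝓝 (z ^ b)) := fun b h =>
    (ENNReal.continuous_rpow_const.tendsto _).comp h
  have hmul : ∀ {w : ℕ → ℝ≥0∞} {z : ℝ≥0∞} (b : ℝ), Tendsto w atTop (𝓝 z) →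
      Tendsto (fun n => ENNReal.ofReal b * w n) atTop (𝓝 (ENNReal.ofReal b * z)) := fun b h =>
    ENNReal.Tendsto.const_mul h (Or.inr ENNReal.ofReal_ne_top)
  rcases lt_trichotomy a 1 with h1 | rfl | h1
  · simp only [kernel_of_lt_one h1]
    have hx1 : x ^ a ≠ ∞ := ENNReal.rpow_ne_top_of_nonneg ha.le hx
    have hy1 : y ^ (1 - a) ≠ ∞ := ENNReal.rpow_ne_top_of_nonneg (by linarith) hy
    exact (ENNReal.Tendsto.sub ((hmul a hu).add (hmul (1 - a) hv))
      (ENNReal.Tendsto.mul (hpow a hu) (Or.inr hy1) (hpow (1 - a) hv) (Or.inr hx1))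
      (Or.inr (ENNReal.mul_ne_top hx1 hy1))).liminf_eq.ge
  · rcases eq_or_ne y 0 with rfl | hy0
    · -- the linear minorants of the kernel at `(x, 0)` take arbitrarily large values
      have hx0 : x ≠ 0 := fun h => h00 ⟨h, rfl⟩
      have hle : ∀ n : ℕ, (n : ℝ≥0∞) * x ≤ liminf (fun n => kernel 1 (u n) (v n)) atTop := by
        intro n
        have h1 : Tendsto (fun k => ENNReal.ofReal n * u k - ENNReal.ofReal (Real.exp n) * v k)
            atTop (𝓝 (ENNReal.ofReal n * x - ENNReal.ofReal (Real.exp n) * 0)) :=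
          ENNReal.Tendsto.sub (hmul n hu) (hmul _ hv) (Or.inr (by simp))
        rw [mul_zero, tsub_zero, ENNReal.ofReal_natCast] at h1
        rw [← h1.liminf_eq]
        refine liminf_le_liminf (Eventually.of_forall fun k => ?_)
        rw [← ENNReal.ofReal_natCast n]
        exact tsub_le_iff_right.2 (mul_le_kernel_one_add n (hu' k) (hv' k))
      have htop : liminf (fun n => kernel 1 (u n) (v n)) atTop = ∞ := by
        by_contra hne
        obtain ⟨n, hn⟩ := ENNReal.exists_nat_mul_gt hx0 hne
        exact (hle n).not_gt hn
      rw [htop]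
      exact le_top
    · have hv0 : ∀ᶠ n in atTop, v n ≠ 0 := hv.eventually_ne hy0
      have hdiv : Tendsto (fun n => (u n / v n).toReal) atTop (𝓝 (x / y).toReal) :=
        (ENNReal.tendsto_toReal (ENNReal.div_ne_top hx hy0)).comp
          (ENNReal.Tendsto.div hu (Or.inr hy0) hv (Or.inl hy))
      have h2 := ENNReal.tendsto_ofReal
        ((InformationTheory.continuous_klFun.tendsto _).comp hdiv)
      have h3 := ENNReal.Tendsto.mul hv (Or.inl hy0) h2 (Or.inr hy)
      have h4 : Tendsto (fun n => kernel 1 (u n) (v n)) atTop (𝓝 (kernel 1 x y)) := by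
        rw [kernel_one, if_neg hy0]
        refine h3.congr' ?_
        filter_upwards [hv0] with n hn
        rw [kernel_one, if_neg hn]
        rfl
      exact h4.liminf_eq.ge
  · simp only [kernel_of_one_lt h1]
    have hxy : x ^ a ≠ 0 ∨ y ^ (1 - a) ≠ ∞ := by
      by_contra! h
      refine h00 ⟨?_, ?_⟩
      · simpa [ENNReal.rpow_eq_zero_iff, ha, ha.not_gt, hx] using h.1
      · have := h.2
        rw [ENNReal.rpow_eq_top_iff] at this
        rcases this with h | h
        · exact h.1
        · exact absurd h.1 hy
    have hyx : y ^ (1 - a) ≠ 0 ∨ x ^ a ≠ ∞ :=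
      Or.inr (ENNReal.rpow_ne_top_of_nonneg ha.le hx)
    exact (ENNReal.Tendsto.sub ((ENNReal.Tendsto.mul (hpow a hu) hxy (hpow (1 - a) hv) hyx).add
      (hmul (a - 1) hv)) (hmul a hu)
      (Or.inr (ENNReal.mul_ne_top ENNReal.ofReal_ne_top hx))).liminf_eq.ge

/-! ### The Hellinger divergence of finite order -/

/-- The (unnormalized) Hellinger divergence of order `a`. It equals `|B - 1|`, where `B` is the
integral of `p ^ a * q ^ (1 - a)`, when `a ≠ 1`, and the Kullback-Leibler divergence when
`a = 1`. In all cases it is an increasing function of the Rényi divergence. In contrast to the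
latter, it satisfies Sibson's identity for plain averages over a prior. -/
noncomputable def hellingerDiv (a : ℝ) (P Q : ProbabilityMeasure Ω) : ℝ≥0∞ :=
  ∫⁻ y, kernel a ((P : Measure Ω).rnDeriv ((P : Measure Ω) + (Q : Measure Ω)) y)
    ((Q : Measure Ω).rnDeriv ((P : Measure Ω) + (Q : Measure Ω)) y)
    ∂((P : Measure Ω) + (Q : Measure Ω))

lemma absolutelyContinuous_add_both (P Q : ProbabilityMeasure Ω) :
    (P : Measure Ω) ≪ (P : Measure Ω) + (Q : Measure Ω) ∧
      (Q : Measure Ω) ≪ (P : Measure Ω) + (Q : Measure Ω) :=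
  ⟨Measure.AbsolutelyContinuous.rfl.add_right _, by
    rw [add_comm]
    exact Measure.AbsolutelyContinuous.rfl.add_right _⟩

lemma measurable_kernel_comp (a : ℝ) {f h : Ω → ℝ≥0∞} (hf : Measurable f) (hh : Measurable h) :
    Measurable fun y => kernel a (f y) (h y) :=
  (measurable_kernel a).comp (hf.prodMk hh)

/-- By homogeneity of the kernel, any dominating reference measure can be used. -/
lemma hellingerDiv_eq_lintegral {a : ℝ} (ha : 0 < a) (P Q : ProbabilityMeasure Ω) (ν : Measure Ω)
    [IsFiniteMeasure ν] (hP : (P : Measure Ω) ≪ ν) (hQ : (Q : Measure Ω) ≪ ν) :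
    hellingerDiv a P Q
      = ∫⁻ y, kernel a ((P : Measure Ω).rnDeriv ν y) ((Q : Measure Ω).rnDeriv ν y) ∂ν := by
  set ν₀ : Measure Ω := (P : Measure Ω) + (Q : Measure Ω) with hν₀
  obtain ⟨hPν₀, hQν₀⟩ : (P : Measure Ω) ≪ ν₀ ∧ (Q : Measure Ω) ≪ ν₀ :=
    absolutelyContinuous_add_both P Q
  have hν : ν₀ ≪ ν := Measure.AbsolutelyContinuous.add_left hP hQ
  have hm := measurable_kernel_comp a (Measure.measurable_rnDeriv (P : Measure Ω) ν₀)
    (Measure.measurable_rnDeriv (Q : Measure Ω) ν₀)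
  rw [hellingerDiv, ← hν₀, ← lintegral_rnDeriv_mul hν hm.aemeasurable]
  apply lintegral_congr_ae
  have hfin := Measure.ae_rnDeriv_ne_zero_imp_of_ae (μ := ν₀) (ν := ν)
    ((Measure.rnDeriv_ne_top (P : Measure Ω) ν₀).and (Measure.rnDeriv_ne_top (Q : Measure Ω) ν₀))
  filter_upwards [Measure.rnDeriv_mul_rnDeriv (κ := ν) hPν₀,
    Measure.rnDeriv_mul_rnDeriv (κ := ν) hQν₀, hfin, Measure.rnDeriv_ne_top ν₀ ν]
    with y h1 h2 h3 h4
  rw [← h1, ← h2, Pi.mul_apply, Pi.mul_apply]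
  rcases eq_or_ne (ν₀.rnDeriv ν y) 0 with h0 | h0
  · rw [h0, zero_mul, mul_zero, mul_zero, kernel_self ha ENNReal.zero_ne_top]
  · rw [kernel_mul ha (h3 h0).1 (h3 h0).2 h4, mul_comm]

lemma hellingerDiv_self {a : ℝ} (ha : 0 < a) (P : ProbabilityMeasure Ω) :
    hellingerDiv a P P = 0 := by
  rw [hellingerDiv_eq_lintegral ha P P P Measure.AbsolutelyContinuous.rfl
    Measure.AbsolutelyContinuous.rfl]
  rw [lintegral_congr_ae (g := fun _ => 0)]
  · simp
  filter_upwards [Measure.rnDeriv_ne_top (P : Measure Ω) (P : Measure Ω)] with y hy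
  exact kernel_self ha hy

lemma hellingerDiv_add_lintegral {a : ℝ} (ha : 0 < a) (ha1 : a < 1) (P Q : ProbabilityMeasure Ω)
    (ν : Measure Ω) [IsFiniteMeasure ν] (hP : (P : Measure Ω) ≪ ν) (hQ : (Q : Measure Ω) ≪ ν) :
    hellingerDiv a P Q + ∫⁻ y, (P : Measure Ω).rnDeriv ν y ^ a
      * (Q : Measure Ω).rnDeriv ν y ^ (1 - a) ∂ν = 1 := by
  rw [hellingerDiv_eq_lintegral ha P Q ν hP hQ, ← lintegral_add_left
    (measurable_kernel_comp a (Measure.measurable_rnDeriv _ _) (Measure.measurable_rnDeriv _ _))]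
  have hae : ∀ᵐ y ∂ν, kernel a ((P : Measure Ω).rnDeriv ν y) ((Q : Measure Ω).rnDeriv ν y)
      + (P : Measure Ω).rnDeriv ν y ^ a * (Q : Measure Ω).rnDeriv ν y ^ (1 - a)
      = ENNReal.ofReal a * (P : Measure Ω).rnDeriv ν y
        + ENNReal.ofReal (1 - a) * (Q : Measure Ω).rnDeriv ν y := by
    filter_upwards [Measure.rnDeriv_ne_top (P : Measure Ω) ν,
      Measure.rnDeriv_ne_top (Q : Measure Ω) ν] with y h1 h2
    exact kernel_add_rpow ha ha1 h1 h2
  rw [lintegral_congr_ae hae, lintegral_add_left ((Measure.measurable_rnDeriv _ _).const_mul _),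
    lintegral_const_mul _ (Measure.measurable_rnDeriv _ _),
    lintegral_const_mul _ (Measure.measurable_rnDeriv _ _), Measure.lintegral_rnDeriv hP,
    Measure.lintegral_rnDeriv hQ, measure_univ, measure_univ, mul_one, mul_one,
    ← ENNReal.ofReal_add ha.le (by linarith)]
  simp

lemma one_add_hellingerDiv {a : ℝ} (ha1 : 1 < a) (P Q : ProbabilityMeasure Ω)
    (ν : Measure Ω) [IsFiniteMeasure ν] (hP : (P : Measure Ω) ≪ ν) (hQ : (Q : Measure Ω) ≪ ν) :
    1 + hellingerDiv a P Q = ∫⁻ y, (P : Measure Ω).rnDeriv ν y ^ a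
      * (Q : Measure Ω).rnDeriv ν y ^ (1 - a) ∂ν := by
  have ha : 0 < a := by linarith
  have hae : ∀ᵐ y ∂ν, kernel a ((P : Measure Ω).rnDeriv ν y) ((Q : Measure Ω).rnDeriv ν y)
      + ENNReal.ofReal a * (P : Measure Ω).rnDeriv ν y
      = (P : Measure Ω).rnDeriv ν y ^ a * (Q : Measure Ω).rnDeriv ν y ^ (1 - a)
        + ENNReal.ofReal (a - 1) * (Q : Measure Ω).rnDeriv ν y := by
    filter_upwards [Measure.rnDeriv_ne_top (P : Measure Ω) ν,
      Measure.rnDeriv_ne_top (Q : Measure Ω) ν] with y h1 h2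
    exact kernel_add_mul ha1 h1 h2
  have h := lintegral_congr_ae hae
  rw [lintegral_add_right _ ((Measure.measurable_rnDeriv _ _).const_mul _),
    lintegral_add_right _ ((Measure.measurable_rnDeriv _ _).const_mul _),
    lintegral_const_mul _ (Measure.measurable_rnDeriv _ _),
    lintegral_const_mul _ (Measure.measurable_rnDeriv _ _), Measure.lintegral_rnDeriv hP,
    Measure.lintegral_rnDeriv hQ, measure_univ, measure_univ, mul_one, mul_one,
    ← hellingerDiv_eq_lintegral ha P Q ν hP hQ] at h
  have h2 : ENNReal.ofReal a = 1 + ENNReal.ofReal (a - 1) := by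
    rw [← ENNReal.ofReal_one, ← ENNReal.ofReal_add zero_le_one (by linarith)]
    congr 1; ring
  rw [h2, ← add_assoc] at h
  rw [add_comm]
  exact (ENNReal.add_left_inj ENNReal.ofReal_ne_top).1 h

/-- At order one the Hellinger divergence is the Kullback-Leibler divergence. -/
lemma hellingerDiv_one (P Q : ProbabilityMeasure Ω) :
    hellingerDiv 1 P Q = InformationTheory.klDiv (P : Measure Ω) (Q : Measure Ω) := by
  rw [InformationTheory.klDiv_eq_lintegral_klFun]
  split_ifs with hac
  · rw [hellingerDiv_eq_lintegral one_pos P Q Q hac Measure.AbsolutelyContinuous.rfl]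
    apply lintegral_congr_ae
    filter_upwards [Measure.rnDeriv_self (Q : Measure Ω)] with y hy
    rw [hy, kernel_one, if_neg one_ne_zero, one_mul, div_one]
  · by_contra hne
    apply hac
    have hm := measurable_kernel_comp 1
      (Measure.measurable_rnDeriv (P : Measure Ω) ((P : Measure Ω) + (Q : Measure Ω)))
      (Measure.measurable_rnDeriv (Q : Measure Ω) ((P : Measure Ω) + (Q : Measure Ω)))
    rw [hellingerDiv] at hne
    have hlt := ae_lt_top hm hne
    obtain ⟨hP, hQ⟩ := absolutelyContinuous_add_both P Q
    -- where the density of `Q` vanishes, so does that of `P`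
    refine Measure.AbsolutelyContinuous.mk fun A hA hQA => ?_
    rw [← Measure.setLIntegral_rnDeriv hQ, lintegral_eq_zero_iff (Measure.measurable_rnDeriv _ _)]
      at hQA
    rw [← Measure.setLIntegral_rnDeriv hP, lintegral_eq_zero_iff (Measure.measurable_rnDeriv _ _)]
    filter_upwards [hQA, ae_restrict_of_ae hlt] with y h1 h2
    rw [Pi.zero_apply] at h1 ⊢
    rw [h1, kernel_one, if_pos rfl] at h2
    by_contra h3
    simp [h3] at h2

/-- An inequality of Pinsker type. -/
lemma exists_tvClose_of_hellingerDiv_le {a : ℝ} (ha : 0 < a) {η : ℝ} (hη : 0 < η) :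
    ∃ δ : ℝ, 0 < δ ∧ ∀ P Q : ProbabilityMeasure Ω, hellingerDiv a P Q ≤ ENNReal.ofReal δ →
      TVClose η P Q := by
  obtain ⟨k, hk, h⟩ := exists_le_add_kernel ha (s := η / 4) (by linarith)
  refine ⟨η / (2 * k), by positivity, fun P Q hPQ => TVClose.of_le fun A hA => ?_⟩
  set ν : Measure Ω := (P : Measure Ω) + (Q : Measure Ω) with hν
  obtain ⟨hP, hQ⟩ : (P : Measure Ω) ≪ ν ∧ (Q : Measure Ω) ≪ ν :=
    absolutelyContinuous_add_both P Q
  have hmP := Measure.measurable_rnDeriv (P : Measure Ω) ν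
  have hmQ := Measure.measurable_rnDeriv (Q : Measure Ω) ν
  have h1 : (P : Measure Ω) A ≤ (Q : Measure Ω) A
      + ENNReal.ofReal (η / 4) * ((P : Measure Ω) A + (Q : Measure Ω) A)
      + ENNReal.ofReal k * hellingerDiv a P Q := by
    calc (P : Measure Ω) A = ∫⁻ y in A, (P : Measure Ω).rnDeriv ν y ∂ν :=
          (Measure.setLIntegral_rnDeriv hP A).symm
      _ ≤ ∫⁻ y in A, ((Q : Measure Ω).rnDeriv ν y
          + ENNReal.ofReal (η / 4) * ((P : Measure Ω).rnDeriv ν y + (Q : Measure Ω).rnDeriv ν y)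
          + ENNReal.ofReal k
            * kernel a ((P : Measure Ω).rnDeriv ν y) ((Q : Measure Ω).rnDeriv ν y)) ∂ν := by
          apply lintegral_mono_ae
          filter_upwards [ae_restrict_of_ae (Measure.rnDeriv_ne_top (P : Measure Ω) ν),
            ae_restrict_of_ae (Measure.rnDeriv_ne_top (Q : Measure Ω) ν)] with y h1 h2
          exact h _ _ h1 h2
      _ = (Q : Measure Ω) A + ENNReal.ofReal (η / 4) * ((P : Measure Ω) A + (Q : Measure Ω) A)
          + ENNReal.ofReal k * ∫⁻ y in A,
            kernel a ((P : Measure Ω).rnDeriv ν y) ((Q : Measure Ω).rnDeriv ν y) ∂ν := by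
          have hm : Measurable fun y => (P : Measure Ω).rnDeriv ν y + (Q : Measure Ω).rnDeriv ν y :=
            hmP.add hmQ
          rw [lintegral_add_right _ ((measurable_kernel_comp a hmP hmQ).const_mul _),
            lintegral_add_left hmQ, lintegral_const_mul _ hm, lintegral_add_left hmP,
            lintegral_const_mul _ (measurable_kernel_comp a hmP hmQ),
            Measure.setLIntegral_rnDeriv hP, Measure.setLIntegral_rnDeriv hQ]
      _ ≤ _ := by
          rw [hellingerDiv, ← hν]
          gcongr
          exact Measure.restrict_le_self
  have h2 : (P : Measure Ω) A ≤ (Q : Measure Ω) A + ENNReal.ofReal η := by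
    calc (P : Measure Ω) A ≤ _ := h1
      _ ≤ (Q : Measure Ω) A + ENNReal.ofReal (η / 4) * (1 + 1)
          + ENNReal.ofReal k * ENNReal.ofReal (η / (2 * k)) := by
        gcongr
        · exact prob_le_one
        · exact prob_le_one
      _ = (Q : Measure Ω) A + ENNReal.ofReal η := by
        rw [add_assoc, ← ENNReal.ofReal_mul hk.le, one_add_one_eq_two,
          ← ENNReal.ofReal_ofNat 2, ← ENNReal.ofReal_mul (by positivity),
          ← ENNReal.ofReal_add (by positivity) (by positivity)]
        congr 2
        field_simp
        ring
  have h3 := ENNReal.toReal_mono (by finiteness) h2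
  rwa [ENNReal.toReal_add (by finiteness) (by finiteness), ENNReal.toReal_ofReal hη.le] at h3

/-- Lower semicontinuity in total variation, by Fatou's lemma. -/
lemma hellingerDiv_le_of_tvClose {a : ℝ} (ha : 0 < a) {P Q : ProbabilityMeasure Ω} {b : ℝ≥0∞}
    (h : ∀ η : ℝ, 0 < η → ∃ P' Q', TVClose η P' P ∧ TVClose η Q' Q ∧ hellingerDiv a P' Q' ≤ b) :
    hellingerDiv a P Q ≤ b := by
  choose p q hp hq hpq using fun n : ℕ => h ((1 / 2) ^ n) (by positivity)
  obtain ⟨ν₁, hν₁, hac₁⟩ := exists_dominating fun n => (p n : Measure Ω)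
  obtain ⟨ν₂, hν₂, hac₂⟩ := exists_dominating fun n => (q n : Measure Ω)
  obtain ⟨ν, hν, hpν, hqν, hP, hQ⟩ : ∃ ν : Measure Ω, IsFiniteMeasure ν ∧
      (∀ n, (p n : Measure Ω) ≪ ν) ∧ (∀ n, (q n : Measure Ω) ≪ ν) ∧ (P : Measure Ω) ≪ ν ∧
      (Q : Measure Ω) ≪ ν := by
    have h1 : ∀ μ₁ μ₂ : Measure Ω, μ₁ ≪ μ₁ + μ₂ := fun _ _ =>
      Measure.AbsolutelyContinuous.rfl.add_right _
    have h2 : ∀ μ₁ μ₂ : Measure Ω, μ₂ ≪ μ₁ + μ₂ := fun μ₁ μ₂ => by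
      rw [add_comm]
      exact h1 _ _
    exact ⟨(ν₁ + ν₂) + (P + Q), inferInstance,
      fun n => ((hac₁ n).trans (h1 _ _)).trans (h1 _ _),
      fun n => ((hac₂ n).trans (h2 _ _)).trans (h1 _ _),
      (h1 _ _).trans (h2 _ _), (h2 _ _).trans (h2 _ _)⟩
  calc hellingerDiv a P Q
      = ∫⁻ y, kernel a ((P : Measure Ω).rnDeriv ν y) ((Q : Measure Ω).rnDeriv ν y) ∂ν :=
        hellingerDiv_eq_lintegral ha P Q ν hP hQ
    _ ≤ ∫⁻ y, liminf (fun n => kernel a ((p n : Measure Ω).rnDeriv ν y)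
        ((q n : Measure Ω).rnDeriv ν y)) atTop ∂ν := by
        apply lintegral_mono_ae
        have hfp : ∀ᵐ y ∂ν, ∀ n, (p n : Measure Ω).rnDeriv ν y ≠ ∞ :=
          ae_all_iff.2 fun n => Measure.rnDeriv_ne_top _ _
        have hfq : ∀ᵐ y ∂ν, ∀ n, (q n : Measure Ω).rnDeriv ν y ≠ ∞ :=
          ae_all_iff.2 fun n => Measure.rnDeriv_ne_top _ _
        filter_upwards [ae_tendsto_rnDeriv hp ν hP hpν, ae_tendsto_rnDeriv hq ν hQ hqν, hfp, hfq,
          Measure.rnDeriv_ne_top (P : Measure Ω) ν, Measure.rnDeriv_ne_top (Q : Measure Ω) ν]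
          with y h1 h2 h3 h4 h5 h6
        exact kernel_le_liminf ha h5 h6 h1 h2 h3 h4
    _ ≤ liminf (fun n => ∫⁻ y, kernel a ((p n : Measure Ω).rnDeriv ν y)
        ((q n : Measure Ω).rnDeriv ν y) ∂ν) atTop :=
        lintegral_liminf_le fun n => measurable_kernel_comp a (Measure.measurable_rnDeriv _ _)
          (Measure.measurable_rnDeriv _ _)
    _ ≤ b := by
        refine (liminf_le_liminf (v := fun _ => b) (Eventually.of_forall fun n => ?_)).trans
          (liminf_const b).le
        rw [← hellingerDiv_eq_lintegral ha (p n) (q n) ν (hpν n) (hqν n)]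
        exact hpq n

/-! ### The Rényi divergence as a function of the Hellinger divergence -/

/-- The increasing function carrying values of the order `a` Rényi divergence to values of the
Hellinger divergence. -/
noncomputable def toHellinger (a r : ℝ) : ℝ :=
  if a < 1 then 1 - Real.exp ((a - 1) * r)
  else if a = 1 then r
  else Real.exp ((a - 1) * r) - 1

lemma toHellinger_of_lt_one {a : ℝ} (ha : a < 1) (r : ℝ) :
    toHellinger a r = 1 - Real.exp ((a - 1) * r) :=
  if_pos ha

lemma toHellinger_one (r : ℝ) : toHellinger 1 r = r := by
  simp [toHellinger]

lemma toHellinger_of_one_lt {a : ℝ} (ha : 1 < a) (r : ℝ) :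
    toHellinger a r = Real.exp ((a - 1) * r) - 1 := by
  rw [toHellinger, if_neg ha.not_gt, if_neg ha.ne']

lemma strictMono_toHellinger (a : ℝ) : StrictMono (toHellinger a) := by
  intro r t hrt
  rcases lt_trichotomy a 1 with ha | rfl | ha
  · rw [toHellinger_of_lt_one ha, toHellinger_of_lt_one ha]
    have : Real.exp ((a - 1) * t) < Real.exp ((a - 1) * r) := Real.exp_lt_exp.2 (by nlinarith)
    linarith
  · rwa [toHellinger_one, toHellinger_one]
  · rw [toHellinger_of_one_lt ha, toHellinger_of_one_lt ha]
    have : Real.exp ((a - 1) * r) < Real.exp ((a - 1) * t) := Real.exp_lt_exp.2 (by nlinarith)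
    linarith

lemma continuous_toHellinger (a : ℝ) : Continuous (toHellinger a) := by
  rcases lt_trichotomy a 1 with ha | rfl | ha
  · simp only [funext (toHellinger_of_lt_one ha)]
    fun_prop
  · simp only [funext toHellinger_one]
    fun_prop
  · simp only [funext (toHellinger_of_one_lt ha)]
    fun_prop

lemma toHellinger_zero (a : ℝ) : toHellinger a 0 = 0 := by
  simp [toHellinger]

lemma toHellinger_add (a r t : ℝ) :
    toHellinger a (r + t) = toHellinger a r + Real.exp ((a - 1) * r) * toHellinger a t := by
  rcases lt_trichotomy a 1 with ha | rfl | ha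
  · simp only [toHellinger_of_lt_one ha, mul_add, Real.exp_add]
    ring
  · simp [toHellinger_one]
  · simp only [toHellinger_of_one_lt ha, mul_add, Real.exp_add]
    ring

lemma toHellinger_nonneg (a : ℝ) {r : ℝ} (hr : 0 ≤ r) : 0 ≤ toHellinger a r := by
  rw [← toHellinger_zero a]
  exact (strictMono_toHellinger a).monotone hr

lemma coe_inv_mul_le_iff_of_pos {c : ℝ} (hc : 0 < c) (x : EReal) (r : ℝ) :
    ((c⁻¹ : ℝ) : EReal) * x ≤ r ↔ x ≤ ((c * r : ℝ) : EReal) := by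
  induction x with
  | bot => rw [EReal.coe_mul_bot_of_pos (by positivity)]; simp
  | top =>
    rw [EReal.coe_mul_top_of_pos (by positivity)]
    simp only [top_le_iff, EReal.coe_ne_top]
  | coe x =>
    rw [← EReal.coe_mul, EReal.coe_le_coe_iff, EReal.coe_le_coe_iff, inv_mul_le_iff₀ hc]

lemma coe_inv_mul_le_iff_of_neg {c : ℝ} (hc : c < 0) (x : EReal) (r : ℝ) :
    ((c⁻¹ : ℝ) : EReal) * x ≤ r ↔ ((c * r : ℝ) : EReal) ≤ x := by
  have hc' : c⁻¹ < 0 := inv_lt_zero.2 hc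
  induction x with
  | bot =>
    rw [EReal.coe_mul_bot_of_neg hc']
    simp only [top_le_iff, le_bot_iff, EReal.coe_ne_top, EReal.coe_ne_bot]
  | top => rw [EReal.coe_mul_top_of_neg hc']; simp
  | coe x =>
    rw [← EReal.coe_mul, EReal.coe_le_coe_iff, EReal.coe_le_coe_iff]
    constructor
    · intro h
      have := mul_le_mul_of_nonpos_left h hc.le
      rwa [mul_inv_cancel_left₀ hc.ne] at this
    · intro h
      have := mul_le_mul_of_nonpos_left h hc'.le
      rwa [inv_mul_cancel_left₀ hc.ne] at this

lemma log_le_coe_iff (x : ℝ≥0∞) (r : ℝ) :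
    ENNReal.log x ≤ r ↔ x ≤ ENNReal.ofReal (Real.exp r) := by
  rw [← EReal.log_exp (r : EReal), ENNReal.log_le_log_iff, EReal.exp_coe]

lemma coe_le_log_iff (x : ℝ≥0∞) (r : ℝ) :
    (r : EReal) ≤ ENNReal.log x ↔ ENNReal.ofReal (Real.exp r) ≤ x := by
  rw [← EReal.log_exp (r : EReal), ENNReal.log_le_log_iff, EReal.exp_coe]

/-- The divergence of a finite positive order, with its order given as a real number. -/
lemma divergence_ofReal {a : ℝ} (ha : 0 < a) (ha1 : a ≠ 1) (P Q : ProbabilityMeasure Ω) :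
    divergence (ENNReal.ofReal a) P Q = (((a - 1)⁻¹ : ℝ) : EReal) * ENNReal.log
      (∫⁻ y, (P : Measure Ω).rnDeriv ((P : Measure Ω) + (Q : Measure Ω)) y ^ a
        * (Q : Measure Ω).rnDeriv ((P : Measure Ω) + (Q : Measure Ω)) y ^ (1 - a)
        ∂((P : Measure Ω) + (Q : Measure Ω))) := by
  simp only [divergence]
  rw [if_neg (by simpa using ha), if_neg (by simpa using ha1), if_neg ENNReal.ofReal_ne_top,
    ENNReal.toReal_ofReal ha.le]

lemma divergence_one (P Q : ProbabilityMeasure Ω) :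
    divergence 1 P Q = (hellingerDiv 1 P Q : EReal) := by
  simp only [divergence]
  rw [if_neg one_ne_zero, if_pos trivial, hellingerDiv_one]

lemma divergence_le_coe_iff {a : ℝ} (ha : 0 < a) (P Q : ProbabilityMeasure Ω) {r : ℝ}
    (hr : 0 ≤ r) : divergence (ENNReal.ofReal a) P Q ≤ r ↔
      hellingerDiv a P Q ≤ ENNReal.ofReal (toHellinger a r) := by
  obtain ⟨hP, hQ⟩ := absolutelyContinuous_add_both P Q
  rcases lt_trichotomy a 1 with h1 | rfl | h1
  · rw [divergence_ofReal ha h1.ne, coe_inv_mul_le_iff_of_neg (by linarith), coe_le_log_iff,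
      toHellinger_of_lt_one h1]
    have h := hellingerDiv_add_lintegral ha h1 P Q _ hP hQ
    set B := ∫⁻ y, (P : Measure Ω).rnDeriv ((P : Measure Ω) + (Q : Measure Ω)) y ^ a
        * (Q : Measure Ω).rnDeriv ((P : Measure Ω) + (Q : Measure Ω)) y ^ (1 - a)
        ∂((P : Measure Ω) + (Q : Measure Ω))
    have hH : hellingerDiv a P Q ≠ ∞ := ne_top_of_le_ne_top ENNReal.one_ne_top (h ▸ le_self_add)
    have hB : B ≠ ∞ := ne_top_of_le_ne_top ENNReal.one_ne_top (h ▸ le_add_self)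
    have he : Real.exp ((a - 1) * r) ≤ 1 := Real.exp_le_one_iff.2 (by nlinarith)
    have hreal := congrArg ENNReal.toReal h
    rw [ENNReal.toReal_add hH hB, ENNReal.toReal_one] at hreal
    rw [ENNReal.ofReal_le_iff_le_toReal hB, ENNReal.le_ofReal_iff_toReal_le hH (by linarith)]
    constructor <;> intro h <;> linarith
  · rw [ENNReal.ofReal_one, divergence_one, toHellinger_one]
    rw [← EReal.coe_ennreal_le_coe_ennreal_iff, EReal.coe_ennreal_ofReal, max_eq_left hr]
  · rw [divergence_ofReal ha h1.ne', coe_inv_mul_le_iff_of_pos (by linarith), log_le_coe_iff,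
      ← one_add_hellingerDiv h1 P Q _ hP hQ, toHellinger_of_one_lt h1,
      ENNReal.ofReal_sub _ zero_le_one, ENNReal.ofReal_one]
    have he : 1 ≤ ENNReal.ofReal (Real.exp ((a - 1) * r)) := by
      rw [← ENNReal.ofReal_one]
      exact ENNReal.ofReal_le_ofReal (Real.one_le_exp (by nlinarith))
    rw [add_comm]
    exact (ENNReal.le_sub_iff_add_le_right ENNReal.one_ne_top he).symm

lemma divergence_nonneg {a : ℝ} (ha : 0 < a) (P Q : ProbabilityMeasure Ω) :
    0 ≤ divergence (ENNReal.ofReal a) P Q := by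
  obtain ⟨hP, hQ⟩ := absolutelyContinuous_add_both P Q
  rcases lt_trichotomy a 1 with h1 | rfl | h1
  · rw [divergence_ofReal ha h1.ne]
    have h := hellingerDiv_add_lintegral ha h1 P Q _ hP hQ
    have hB := ENNReal.log_le_zero_iff.2 (h ▸ le_add_self :
      ∫⁻ y, (P : Measure Ω).rnDeriv ((P : Measure Ω) + (Q : Measure Ω)) y ^ a
        * (Q : Measure Ω).rnDeriv ((P : Measure Ω) + (Q : Measure Ω)) y ^ (1 - a)
        ∂((P : Measure Ω) + (Q : Measure Ω)) ≤ 1)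
    exact EReal.mul_nonneg_iff.2 (Or.inr ⟨by exact_mod_cast (inv_lt_zero.2 (by linarith)).le, hB⟩)
  · rw [ENNReal.ofReal_one, divergence_one]
    exact EReal.coe_ennreal_nonneg _
  · rw [divergence_ofReal ha h1.ne', ← one_add_hellingerDiv h1 P Q _ hP hQ]
    refine EReal.mul_nonneg_iff.2 (Or.inl ⟨?_, ENNReal.zero_le_log_iff.2 le_self_add⟩)
    exact_mod_cast (inv_pos.2 (by linarith : 0 < a - 1)).le

/-! ### Mean measures -/

lemma sum_coe_eq_one {p : ProbabilityMeasure Ω →₀ ℝ≥0} {𝒲 : Set (ProbabilityMeasure Ω)}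
    (hp : p ∈ priors 𝒲) : ∑ W ∈ p.support, (p W : ℝ≥0∞) = 1 := by
  exact_mod_cast hp.2

lemma support_nonempty {p : ProbabilityMeasure Ω →₀ ℝ≥0} {𝒲 : Set (ProbabilityMeasure Ω)}
    (hp : p ∈ priors 𝒲) : p.support.Nonempty := by
  by_contra h
  have := hp.2
  rw [Finset.not_nonempty_iff_eq_empty.1 h] at this
  simp at this

lemma coe_ne_zero_of_mem_support {p : ProbabilityMeasure Ω →₀ ℝ≥0} {W : ProbabilityMeasure Ω}
    (hW : W ∈ p.support) : (p W : ℝ≥0∞) ≠ 0 := by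
  simpa using hW

lemma mixture_apply (p : ProbabilityMeasure Ω →₀ ℝ≥0) (A : Set Ω) :
    mixture p A = ∑ W ∈ p.support, (p W : ℝ≥0∞) * (W : Measure Ω) A := by
  simp [mixture]

lemma isProbabilityMeasure_mixture {p : ProbabilityMeasure Ω →₀ ℝ≥0}
    {𝒲 : Set (ProbabilityMeasure Ω)} (hp : p ∈ priors 𝒲) : IsProbabilityMeasure (mixture p) := by
  constructor
  rw [mixture_apply]
  simp only [measure_univ, mul_one]
  exact sum_coe_eq_one hp

lemma absolutelyContinuous_mixture {p : ProbabilityMeasure Ω →₀ ℝ≥0} {W : ProbabilityMeasure Ω}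
    (hW : W ∈ p.support) : (W : Measure Ω) ≪ mixture p := by
  intro A hA
  rw [mixture_apply, Finset.sum_eq_zero_iff] at hA
  exact (mul_eq_zero.1 (hA W hW)).resolve_left (coe_ne_zero_of_mem_support hW)

lemma measurable_density (p : ProbabilityMeasure Ω →₀ ℝ≥0) (W : ProbabilityMeasure Ω) :
    Measurable (density p W) :=
  Measure.measurable_rnDeriv _ _

lemma ae_sum_mul_density {p : ProbabilityMeasure Ω →₀ ℝ≥0} {𝒲 : Set (ProbabilityMeasure Ω)}
    (hp : p ∈ priors 𝒲) :
    ∀ᵐ y ∂mixture p, ∑ W ∈ p.support, (p W : ℝ≥0∞) * density p W y = 1 := by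
  have := isProbabilityMeasure_mixture hp
  refine ae_eq_of_forall_setLIntegral_eq_of_sigmaFinite
    (Finset.measurable_fun_sum _ fun W _ => (measurable_density p W).const_mul _) measurable_const
    fun A _ _ => ?_
  rw [lintegral_finsetSum _ fun W _ => (measurable_density p W).const_mul _, setLIntegral_one,
    mixture_apply]
  refine Finset.sum_congr rfl fun W hW => ?_
  rw [lintegral_const_mul _ (measurable_density p W)]
  unfold density
  rw [Measure.setLIntegral_rnDeriv (absolutelyContinuous_mixture hW)]

lemma meanDensity_top (p : ProbabilityMeasure Ω →₀ ℝ≥0) (y : Ω) :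
    meanDensity ∞ p y = p.support.sup fun W => density p W y := by
  simp [meanDensity]

lemma meanDensity_ofReal {a : ℝ} (ha : 0 < a) (p : ProbabilityMeasure Ω →₀ ℝ≥0) (y : Ω) :
    meanDensity (ENNReal.ofReal a) p y
      = (∑ W ∈ p.support, (p W : ℝ≥0∞) * density p W y ^ a) ^ a⁻¹ := by
  simp only [meanDensity]
  rw [if_neg (by simpa using ha), if_neg ENNReal.ofReal_ne_top, ENNReal.toReal_ofReal ha.le]

lemma meanDensity_ofReal_rpow {a : ℝ} (ha : 0 < a) (p : ProbabilityMeasure Ω →₀ ℝ≥0) (y : Ω) :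
    meanDensity (ENNReal.ofReal a) p y ^ a
      = ∑ W ∈ p.support, (p W : ℝ≥0∞) * density p W y ^ a := by
  rw [meanDensity_ofReal ha, ENNReal.rpow_inv_rpow ha.ne']

lemma eq_top_or_eq_ofReal {α : ℝ≥0∞} (hα : 0 < α) :
    α = ∞ ∨ ∃ a : ℝ, 0 < a ∧ α = ENNReal.ofReal a := by
  rcases eq_or_ne α ∞ with h | h
  · exact Or.inl h
  · exact Or.inr ⟨α.toReal, ENNReal.toReal_pos hα.ne' h, (ENNReal.ofReal_toReal h).symm⟩

lemma measurable_meanDensity {α : ℝ≥0∞} (hα : 0 < α) (p : ProbabilityMeasure Ω →₀ ℝ≥0) :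
    Measurable (meanDensity α p) := by
  rcases eq_top_or_eq_ofReal hα with rfl | ⟨a, ha, rfl⟩
  · rw [funext (meanDensity_top p)]
    have h : (fun y => p.support.sup fun W => density p W y)
        = p.support.sup fun W => density p W := by
      ext y
      rw [Finset.sup_apply]
    rw [h]
    exact Finset.sup_induction measurable_const (fun _ h₁ _ h₂ => h₁.sup h₂)
      fun W _ => measurable_density p W
  · rw [funext (meanDensity_ofReal ha p)]
    exact (Finset.measurable_fun_sum _ fun W _ =>
      ((measurable_density p W).pow_const a).const_mul _).pow_const _

/-- All power means are at most the sum of the densities. -/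
lemma meanDensity_le_sum {α : ℝ≥0∞} (hα : 0 < α) {p : ProbabilityMeasure Ω →₀ ℝ≥0}
    {𝒲 : Set (ProbabilityMeasure Ω)} (hp : p ∈ priors 𝒲) (y : Ω) :
    meanDensity α p y ≤ ∑ W ∈ p.support, density p W y := by
  have hle : ∀ W ∈ p.support, density p W y ≤ ∑ W ∈ p.support, density p W y := fun W hW =>
    Finset.single_le_sum (f := fun W => density p W y) (fun _ _ => zero_le) hW
  rcases eq_top_or_eq_ofReal hα with rfl | ⟨a, ha, rfl⟩
  · rw [meanDensity_top]
    exact Finset.sup_le hle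
  · rw [meanDensity_ofReal ha, ENNReal.rpow_inv_le_iff ha]
    calc ∑ W ∈ p.support, (p W : ℝ≥0∞) * density p W y ^ a
        ≤ ∑ W ∈ p.support, (p W : ℝ≥0∞) * (∑ W ∈ p.support, density p W y) ^ a := by
          refine Finset.sum_le_sum fun W hW => ?_
          gcongr
          exact hle W hW
      _ = _ := by rw [← Finset.sum_mul, sum_coe_eq_one hp, one_mul]

lemma density_eq_zero_of_meanDensity {α : ℝ≥0∞} (hα : 0 < α) {p : ProbabilityMeasure Ω →₀ ℝ≥0}
    {y : Ω} (h : meanDensity α p y = 0) {W : ProbabilityMeasure Ω} (hW : W ∈ p.support) :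
    density p W y = 0 := by
  rcases eq_top_or_eq_ofReal hα with rfl | ⟨a, ha, rfl⟩
  · rw [meanDensity_top] at h
    exact le_antisymm (h ▸ Finset.le_sup (f := fun W => density p W y) hW) zero_le
  · have h1 := meanDensity_ofReal_rpow ha p y
    rw [h, ENNReal.zero_rpow_of_pos ha] at h1
    have h2 := (mul_eq_zero.1 (Finset.sum_eq_zero_iff.1 h1.symm W hW)).resolve_left
      (coe_ne_zero_of_mem_support hW)
    simpa [ENNReal.rpow_eq_zero_iff, ha, ha.not_gt] using h2

lemma lintegral_density {p : ProbabilityMeasure Ω →₀ ℝ≥0} {𝒲 : Set (ProbabilityMeasure Ω)}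
    (hp : p ∈ priors 𝒲) {W : ProbabilityMeasure Ω} (hW : W ∈ p.support) :
    ∫⁻ y, density p W y ∂mixture p = 1 := by
  have := isProbabilityMeasure_mixture hp
  unfold density
  rw [Measure.lintegral_rnDeriv (absolutelyContinuous_mixture hW), measure_univ]

lemma meanMeasure_univ (α : ℝ≥0∞) (p : ProbabilityMeasure Ω →₀ ℝ≥0) :
    meanMeasure α p Set.univ = ∫⁻ y, meanDensity α p y ∂mixture p := by
  rw [meanMeasure, withDensity_apply _ MeasurableSet.univ, Measure.restrict_univ]

lemma meanMeasure_univ_ne_top {α : ℝ≥0∞} (hα : 0 < α) {p : ProbabilityMeasure Ω →₀ ℝ≥0}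
    {𝒲 : Set (ProbabilityMeasure Ω)} (hp : p ∈ priors 𝒲) : meanMeasure α p Set.univ ≠ ∞ := by
  rw [meanMeasure_univ]
  refine ne_top_of_le_ne_top ?_ (lintegral_mono (meanDensity_le_sum hα hp))
  rw [lintegral_finsetSum _ fun W _ => measurable_density p W,
    Finset.sum_congr rfl fun W hW => lintegral_density hp hW]
  simp

lemma meanMeasure_univ_ne_zero {α : ℝ≥0∞} (hα : 0 < α) {p : ProbabilityMeasure Ω →₀ ℝ≥0}
    {𝒲 : Set (ProbabilityMeasure Ω)} (hp : p ∈ priors 𝒲) : meanMeasure α p Set.univ ≠ 0 := by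
  intro h
  rw [meanMeasure_univ, lintegral_eq_zero_iff (measurable_meanDensity hα p)] at h
  obtain ⟨W, hW⟩ := support_nonempty hp
  have h1 := lintegral_density hp hW
  rw [lintegral_congr_ae (g := fun _ => 0)] at h1
  · simp at h1
  · filter_upwards [h] with y hy
    exact density_eq_zero_of_meanDensity hα hy hW

/-- The mean measure is finite and nonzero, so it can be normalized. -/
lemma exists_normalized_meanMeasure {α : ℝ≥0∞} (hα : 0 < α) {p : ProbabilityMeasure Ω →₀ ℝ≥0}
    {𝒲 : Set (ProbabilityMeasure Ω)} (hp : p ∈ priors 𝒲) :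
    ∃ c : ProbabilityMeasure Ω,
      (c : Measure Ω) = (meanMeasure α p Set.univ)⁻¹ • meanMeasure α p := by
  refine ⟨⟨(meanMeasure α p Set.univ)⁻¹ • meanMeasure α p, ⟨?_⟩⟩, rfl⟩
  rw [Measure.smul_apply, smul_eq_mul]
  exact ENNReal.inv_mul_cancel (meanMeasure_univ_ne_zero hα hp) (meanMeasure_univ_ne_top hα hp)

/-! ### Sibson's identity -/

/-- The normalized mean measure of order `a` is a power mean also in terms of densities with respect
to a reference measure other than the mixture. -/
lemma ae_sum_mul_rnDeriv_rpow {a : ℝ} (ha : 0 < a) {p : ProbabilityMeasure Ω →₀ ℝ≥0}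
    {𝒲 : Set (ProbabilityMeasure Ω)} (hp : p ∈ priors 𝒲) {c : ProbabilityMeasure Ω}
    (hc : (c : Measure Ω) = (meanMeasure (ENNReal.ofReal a) p Set.univ)⁻¹
      • meanMeasure (ENNReal.ofReal a) p)
    (ν : Measure Ω) [IsFiniteMeasure ν] :
    ∀ᵐ y ∂ν, ∑ W ∈ p.support, (p W : ℝ≥0∞) * (W : Measure Ω).rnDeriv ν y ^ a
      = meanMeasure (ENNReal.ofReal a) p Set.univ ^ a * (c : Measure Ω).rnDeriv ν y ^ a := by
  have := isProbabilityMeasure_mixture hp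
  have hα : 0 < ENNReal.ofReal a := ENNReal.ofReal_pos.2 ha
  have hN0 := meanMeasure_univ_ne_zero hα hp
  have hNtop := meanMeasure_univ_ne_top hα hp
  set N := meanMeasure (ENNReal.ofReal a) p Set.univ
  have hcm : (c : Measure Ω)
      = (mixture p).withDensity (N⁻¹ • meanDensity (ENNReal.ofReal a) p) := by
    rw [hc, meanMeasure, withDensity_smul _ (measurable_meanDensity hα p)]
  have hcac : (c : Measure Ω) ≪ mixture p := by
    rw [hcm]
    exact withDensity_absolutelyContinuous _ _
  have hcd : (c : Measure Ω).rnDeriv (mixture p)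
      =ᵐ[mixture p] N⁻¹ • meanDensity (ENNReal.ofReal a) p := by
    rw [hcm]
    exact Measure.rnDeriv_withDensity _ ((measurable_meanDensity hα p).const_smul _)
  have hW : ∀ᵐ y ∂ν, ∀ W ∈ p.support, density p W y * (mixture p).rnDeriv ν y
      = (W : Measure Ω).rnDeriv ν y := by
    rw [Finset.eventually_all]
    exact fun W hW => Measure.rnDeriv_mul_rnDeriv (κ := ν) (absolutelyContinuous_mixture hW)
  filter_upwards [hW, Measure.rnDeriv_mul_rnDeriv (κ := ν) hcac,
    Measure.ae_rnDeriv_ne_zero_imp_of_ae (ν := ν) hcd] with y h1 h2 h3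
  have h4 : (c : Measure Ω).rnDeriv ν y
      = N⁻¹ * meanDensity (ENNReal.ofReal a) p y * (mixture p).rnDeriv ν y := by
    rw [← h2, Pi.mul_apply]
    rcases eq_or_ne ((mixture p).rnDeriv ν y) 0 with h0 | h0
    · rw [h0, mul_zero, mul_zero]
    · rw [h3 h0]
      rfl
  rw [h4, ← ENNReal.mul_rpow_of_nonneg _ _ ha.le, mul_assoc, ← mul_assoc N,
    ENNReal.mul_inv_cancel hN0 hNtop, one_mul, ENNReal.mul_rpow_of_nonneg _ _ ha.le,
    meanDensity_ofReal_rpow ha, Finset.sum_mul]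
  refine Finset.sum_congr rfl fun W hW => ?_
  rw [← h1 W hW, ENNReal.mul_rpow_of_nonneg _ _ ha.le, mul_assoc]

lemma sum_mul_lintegral_rpow {a : ℝ} (ha : 0 < a) {p : ProbabilityMeasure Ω →₀ ℝ≥0}
    {𝒲 : Set (ProbabilityMeasure Ω)} (hp : p ∈ priors 𝒲) {c : ProbabilityMeasure Ω}
    (hc : (c : Measure Ω) = (meanMeasure (ENNReal.ofReal a) p Set.univ)⁻¹
      • meanMeasure (ENNReal.ofReal a) p)
    (ν : Measure Ω) [IsFiniteMeasure ν] {h : Ω → ℝ≥0∞} (hh : Measurable h) :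
    ∑ W ∈ p.support, (p W : ℝ≥0∞) * ∫⁻ y, (W : Measure Ω).rnDeriv ν y ^ a * h y ∂ν
      = meanMeasure (ENNReal.ofReal a) p Set.univ ^ a
        * ∫⁻ y, (c : Measure Ω).rnDeriv ν y ^ a * h y ∂ν := by
  have hm : ∀ P : Measure Ω, Measurable fun y => P.rnDeriv ν y ^ a * h y := fun P =>
    ((Measure.measurable_rnDeriv P ν).pow_const a).mul hh
  rw [← lintegral_const_mul _ (hm _),
    Finset.sum_congr rfl fun W _ => (lintegral_const_mul (p W : ℝ≥0∞) (hm W)).symm,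
    ← lintegral_finsetSum p.support (f := fun W y => (p W : ℝ≥0∞)
      * ((W : Measure Ω).rnDeriv ν y ^ a * h y)) fun W _ => (hm W).const_mul _]
  apply lintegral_congr_ae
  filter_upwards [ae_sum_mul_rnDeriv_rpow ha hp hc ν] with y hy
  rw [← mul_assoc, ← hy, Finset.sum_mul]
  exact Finset.sum_congr rfl fun W _ => (mul_assoc _ _ _).symm

lemma information_ofReal {a : ℝ} (ha : 0 < a) (ha1 : a ≠ 1) (p : ProbabilityMeasure Ω →₀ ℝ≥0) :
    information (ENNReal.ofReal a) p = ((a / (a - 1) : ℝ) : EReal)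
      * ENNReal.log (meanMeasure (ENNReal.ofReal a) p Set.univ) := by
  simp only [information]
  rw [if_neg (by simpa using ha), if_neg (by simpa using ha1), if_neg ENNReal.ofReal_ne_top,
    ENNReal.toReal_ofReal ha.le]

/-- The information of order `a ≠ 1` is determined by `‖μ‖ ^ a`, where `μ` is the mean measure. -/
lemma exists_information_eq {a : ℝ} (ha : 0 < a) (ha1 : a ≠ 1) {p : ProbabilityMeasure Ω →₀ ℝ≥0}
    {𝒲 : Set (ProbabilityMeasure Ω)} (hp : p ∈ priors 𝒲) :
    ∃ i : ℝ, information (ENNReal.ofReal a) p = i ∧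
      meanMeasure (ENNReal.ofReal a) p Set.univ ^ a = ENNReal.ofReal (Real.exp ((a - 1) * i)) := by
  have hα : 0 < ENNReal.ofReal a := ENNReal.ofReal_pos.2 ha
  have hN0 := meanMeasure_univ_ne_zero hα hp
  have hNtop := meanMeasure_univ_ne_top hα hp
  rw [information_ofReal ha ha1]
  set N := meanMeasure (ENNReal.ofReal a) p Set.univ
  have hpos : 0 < N.toReal := ENNReal.toReal_pos hN0 hNtop
  have ha1' : a - 1 ≠ 0 := sub_ne_zero.2 ha1
  refine ⟨a / (a - 1) * Real.log N.toReal, ?_, ?_⟩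
  · rw [ENNReal.log_pos_real hN0 hNtop, EReal.coe_mul]
  · rw [show (a - 1) * (a / (a - 1) * Real.log N.toReal) = Real.log N.toReal * a by
      field_simp, ← Real.rpow_def_of_pos hpos, ← ENNReal.ofReal_rpow_of_pos hpos,
      ENNReal.ofReal_toReal hNtop]

lemma exists_sibson_of_ne_one {a : ℝ} (ha : 0 < a) (ha1 : a ≠ 1)
    {p : ProbabilityMeasure Ω →₀ ℝ≥0} {𝒲 : Set (ProbabilityMeasure Ω)} (hp : p ∈ priors 𝒲) :
    ∃ (c : ProbabilityMeasure Ω) (i : ℝ), 0 ≤ i ∧ information (ENNReal.ofReal a) p = i ∧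
      ∀ Q, ∑ W ∈ p.support, (p W : ℝ≥0∞) * hellingerDiv a W Q
        = ENNReal.ofReal (toHellinger a i)
          + ENNReal.ofReal (Real.exp ((a - 1) * i)) * hellingerDiv a c Q := by
  have := isProbabilityMeasure_mixture hp
  have hα : 0 < ENNReal.ofReal a := ENNReal.ofReal_pos.2 ha
  obtain ⟨c, hc⟩ := exists_normalized_meanMeasure hα hp
  obtain ⟨i, hi, hN⟩ := exists_information_eq ha ha1 hp
  have hcac : (c : Measure Ω) ≪ mixture p := by
    rw [hc]
    exact (withDensity_absolutelyContinuous _ _).smul_left _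
  have hdom : ∀ Q : ProbabilityMeasure Ω, ∃ ν : Measure Ω, IsFiniteMeasure ν ∧
      mixture p ≪ ν ∧ (Q : Measure Ω) ≪ ν := fun Q =>
    ⟨mixture p + Q, inferInstance, Measure.AbsolutelyContinuous.rfl.add_right _, by
      rw [add_comm]
      exact Measure.AbsolutelyContinuous.rfl.add_right _⟩
  set E := ENNReal.ofReal (Real.exp ((a - 1) * i)) with hE
  have hEtop : E ≠ ∞ := ENNReal.ofReal_ne_top
  rcases lt_or_gt_of_ne ha1 with h1 | h1
  · have key : ∀ Q, ∃ B, hellingerDiv a c Q + B = 1 ∧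
        ∑ W ∈ p.support, (p W : ℝ≥0∞) * hellingerDiv a W Q + E * B = 1 := by
      intro Q
      obtain ⟨ν, hν, hmν, hQν⟩ := hdom Q
      refine ⟨_, hellingerDiv_add_lintegral ha h1 c Q ν (hcac.trans hmν) hQν, ?_⟩
      rw [← hN, ← sum_mul_lintegral_rpow ha hp hc ν
        ((Measure.measurable_rnDeriv _ _).pow_const _), ← Finset.sum_add_distrib,
        ← sum_coe_eq_one hp]
      refine Finset.sum_congr rfl fun W hW => ?_
      rw [← mul_add, hellingerDiv_add_lintegral ha h1 W Q ν
        ((absolutelyContinuous_mixture hW).trans hmν) hQν, mul_one]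
    have hE1 : E ≤ 1 := by
      obtain ⟨B, hB1, hB2⟩ := key c
      rw [hellingerDiv_self ha, zero_add] at hB1
      rw [hB1, mul_one] at hB2
      exact hB2 ▸ le_add_self
    have hexp : Real.exp ((a - 1) * i) ≤ 1 := by
      rwa [hE, ENNReal.ofReal_le_one] at hE1
    refine ⟨c, i, ?_, hi, fun Q => ?_⟩
    · have := Real.exp_le_one_iff.1 hexp
      by_contra! hneg
      nlinarith
    · obtain ⟨B, hB1, hB2⟩ := key Q
      have hB : B ≠ ∞ := ne_top_of_le_ne_top ENNReal.one_ne_top (hB1 ▸ le_add_self)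
      have h2 : ENNReal.ofReal (toHellinger a i) + E = 1 := by
        rw [toHellinger_of_lt_one h1, hE, ← ENNReal.ofReal_add (by linarith) (by positivity)]
        simp
      refine (ENNReal.add_left_inj (ENNReal.mul_ne_top hEtop hB)).1 ?_
      rw [hB2, add_assoc, ← mul_add, hB1, mul_one, h2]
  · have key : ∀ Q, 1 + ∑ W ∈ p.support, (p W : ℝ≥0∞) * hellingerDiv a W Q
        = E * (1 + hellingerDiv a c Q) := by
      intro Q
      obtain ⟨ν, hν, hmν, hQν⟩ := hdom Q
      rw [one_add_hellingerDiv h1 c Q ν (hcac.trans hmν) hQν, ← hN,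
        ← sum_mul_lintegral_rpow ha hp hc ν ((Measure.measurable_rnDeriv _ _).pow_const _),
        ← sum_coe_eq_one hp, ← Finset.sum_add_distrib]
      refine Finset.sum_congr rfl fun W hW => ?_
      rw [← one_add_hellingerDiv h1 W Q ν ((absolutelyContinuous_mixture hW).trans hmν) hQν,
        mul_add, mul_one]
    have hE1 : 1 ≤ E := by
      have h2 := key c
      rw [hellingerDiv_self ha, add_zero, mul_one] at h2
      exact h2 ▸ le_self_add
    have hexp : 1 ≤ Real.exp ((a - 1) * i) := by
      rwa [hE, ENNReal.one_le_ofReal] at hE1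
    refine ⟨c, i, ?_, hi, fun Q => ?_⟩
    · have := Real.one_le_exp_iff.1 hexp
      by_contra! hneg
      nlinarith
    · have h2 : 1 + ENNReal.ofReal (toHellinger a i) = E := by
        rw [toHellinger_of_one_lt h1, hE, ← ENNReal.ofReal_one,
          ← ENNReal.ofReal_add zero_le_one (by linarith)]
        simp
      refine (ENNReal.add_right_inj ENNReal.one_ne_top).1 ?_
      rw [key Q, ← add_assoc, h2, mul_add, mul_one]

lemma kernel_one_eq_ofReal {x y : ℝ≥0∞} (hy : y ≠ ∞) (hy0 : y ≠ 0) :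
    kernel 1 x y = ENNReal.ofReal
      (x.toReal * Real.log (x.toReal / y.toReal) + y.toReal - x.toReal) := by
  have hyp : 0 < y.toReal := ENNReal.toReal_pos hy0 hy
  rw [kernel_one, if_neg hy0]
  nth_rewrite 1 [← ENNReal.ofReal_toReal hy]
  rw [← ENNReal.ofReal_mul hyp.le, ENNReal.toReal_div, InformationTheory.klFun_apply]
  congr 1
  field_simp

lemma mul_log_div_add_sub_nonneg {x y : ℝ} (hx : 0 ≤ x) (hy : 0 < y) :
    0 ≤ x * Real.log (x / y) + y - x := by
  have h := mul_nonneg hy.le (InformationTheory.klFun_nonneg (x := x / y) (by positivity))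
  rw [InformationTheory.klFun_apply] at h
  have h2 : y * (x / y * Real.log (x / y) + 1 - x / y) = x * Real.log (x / y) + y - x := by
    field_simp
  rwa [h2] at h

/-- The pointwise form of the compensation identity for the relative entropy: averaging over
points with mean `r`, the kernel relative to `q` exceeds the kernel relative to `r` by
`kernel 1 r q`. -/
lemma sum_mul_kernel_one {ι : Type*} {s : Finset ι} {p x : ι → ℝ≥0∞} {r q : ℝ≥0∞}
    (hp : ∑ i ∈ s, p i = 1) (hp0 : ∀ i ∈ s, p i ≠ 0) (hx : ∀ i ∈ s, x i ≠ ∞) (hr : r ≠ ∞)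
    (hq : q ≠ ∞) (hpx : ∑ i ∈ s, p i * x i = r) :
    ∑ i ∈ s, p i * kernel 1 (x i) q = ∑ i ∈ s, p i * kernel 1 (x i) r + kernel 1 r q := by
  have hpt : ∀ i ∈ s, p i ≠ ∞ := fun i hi =>
    ne_top_of_le_ne_top ENNReal.one_ne_top (hp ▸ Finset.single_le_sum (fun _ _ => zero_le) hi)
  rcases eq_or_ne r 0 with rfl | hr0
  · have hx0 : ∀ i ∈ s, x i = 0 := fun i hi =>
      (mul_eq_zero.1 (Finset.sum_eq_zero_iff.1 hpx i hi)).resolve_left (hp0 i hi)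
    have h1 : ∑ i ∈ s, p i * kernel 1 (x i) 0 = 0 := Finset.sum_eq_zero fun i hi => by
      rw [hx0 i hi, kernel_self one_pos ENNReal.zero_ne_top, mul_zero]
    have h2 : ∑ i ∈ s, p i * kernel 1 (x i) q = ∑ i ∈ s, p i * kernel 1 0 q :=
      Finset.sum_congr rfl fun i hi => by rw [hx0 i hi]
    rw [h1, h2, ← Finset.sum_mul, hp, one_mul, zero_add]
  rcases eq_or_ne q 0 with rfl | hq0
  · rw [kernel_zero_right le_rfl hr0 hr, add_top]
    obtain ⟨i, hi, hne⟩ := Finset.exists_ne_zero_of_sum_ne_zero (hpx.symm ▸ hr0)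
    refine top_le_iff.1 (le_trans ?_ (Finset.single_le_sum (fun _ _ => zero_le) hi))
    rw [kernel_zero_right le_rfl (right_ne_zero_of_mul hne) (hx i hi), ENNReal.mul_top (hp0 i hi)]
  have hrp : 0 < r.toReal := ENNReal.toReal_pos hr0 hr
  have hqp : 0 < q.toReal := ENNReal.toReal_pos hq0 hq
  have hterm : ∀ t : ℝ≥0∞, t ≠ 0 → t ≠ ∞ → ∑ i ∈ s, p i * kernel 1 (x i) t
      = ENNReal.ofReal (∑ i ∈ s, (p i).toReal * ((x i).toReal
        * Real.log ((x i).toReal / t.toReal) + t.toReal - (x i).toReal)) := by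
    intro t ht0 ht
    have htp : 0 < t.toReal := ENNReal.toReal_pos ht0 ht
    rw [ENNReal.ofReal_sum_of_nonneg fun i _ => mul_nonneg ENNReal.toReal_nonneg
      (mul_log_div_add_sub_nonneg ENNReal.toReal_nonneg htp)]
    refine Finset.sum_congr rfl fun i hi => ?_
    rw [kernel_one_eq_ofReal ht ht0, ENNReal.ofReal_mul ENNReal.toReal_nonneg,
      ENNReal.ofReal_toReal (hpt i hi)]
  rw [hterm q hq0 hq, hterm r hr0 hr, kernel_one_eq_ofReal hq hq0, ← ENNReal.ofReal_add
    (Finset.sum_nonneg fun i _ => mul_nonneg ENNReal.toReal_nonneg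
      (mul_log_div_add_sub_nonneg ENNReal.toReal_nonneg hrp))
    (mul_log_div_add_sub_nonneg hrp.le hqp)]
  congr 1
  have hp' : ∑ i ∈ s, (p i).toReal = 1 := by
    rw [← ENNReal.toReal_sum hpt, hp, ENNReal.toReal_one]
  have hpx' : ∑ i ∈ s, (p i).toReal * (x i).toReal = r.toReal := by
    rw [← hpx, ENNReal.toReal_sum fun i hi => ENNReal.mul_ne_top (hpt i hi) (hx i hi)]
    exact Finset.sum_congr rfl fun i _ => ENNReal.toReal_mul.symm
  have hdiff : ∀ i ∈ s, (p i).toReal * ((x i).toReal * Real.log ((x i).toReal / q.toReal)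
      + q.toReal - (x i).toReal) = (p i).toReal * ((x i).toReal
        * Real.log ((x i).toReal / r.toReal) + r.toReal - (x i).toReal)
      + ((p i).toReal * (x i).toReal * Real.log (r.toReal / q.toReal)
        + (p i).toReal * (q.toReal - r.toReal)) := by
    intro i _
    rcases (ENNReal.toReal_nonneg (a := x i)).eq_or_lt with h | h
    · rw [← h]
      ring
    · rw [Real.log_div h.ne' hqp.ne', Real.log_div h.ne' hrp.ne', Real.log_div hrp.ne' hqp.ne']
      ring
  rw [Finset.sum_congr rfl hdiff, Finset.sum_add_distrib, Finset.sum_add_distrib, ← Finset.sum_mul,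
    ← Finset.sum_mul, hp', hpx']
  ring

lemma ae_sum_mul_rnDeriv {p : ProbabilityMeasure Ω →₀ ℝ≥0} {𝒲 : Set (ProbabilityMeasure Ω)}
    (hp : p ∈ priors 𝒲) (ν : Measure Ω) [IsFiniteMeasure ν] :
    ∀ᵐ y ∂ν, ∑ W ∈ p.support, (p W : ℝ≥0∞) * (W : Measure Ω).rnDeriv ν y
      = (mixture p).rnDeriv ν y := by
  have := isProbabilityMeasure_mixture hp
  have hW : ∀ᵐ y ∂ν, ∀ W ∈ p.support, density p W y * (mixture p).rnDeriv ν y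
      = (W : Measure Ω).rnDeriv ν y := by
    rw [Finset.eventually_all]
    exact fun W hW => Measure.rnDeriv_mul_rnDeriv (κ := ν) (absolutelyContinuous_mixture hW)
  filter_upwards [hW, Measure.ae_rnDeriv_ne_zero_imp_of_ae (ν := ν) (ae_sum_mul_density hp)]
    with y h1 h2
  rw [Finset.sum_congr rfl fun W hW => by rw [← h1 W hW, ← mul_assoc], ← Finset.sum_mul]
  rcases eq_or_ne ((mixture p).rnDeriv ν y) 0 with h0 | h0
  · rw [h0, mul_zero]
  · rw [h2 h0, one_mul]

/-- The compensation identity for the relative entropy. -/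
lemma sum_mul_hellingerDiv_one {p : ProbabilityMeasure Ω →₀ ℝ≥0} {𝒲 : Set (ProbabilityMeasure Ω)}
    (hp : p ∈ priors 𝒲) {c : ProbabilityMeasure Ω} (hc : (c : Measure Ω) = mixture p)
    (Q : ProbabilityMeasure Ω) :
    ∑ W ∈ p.support, (p W : ℝ≥0∞) * hellingerDiv 1 W Q
      = ∑ W ∈ p.support, (p W : ℝ≥0∞) * hellingerDiv 1 W c + hellingerDiv 1 c Q := by
  obtain ⟨hcν, hQν⟩ := absolutelyContinuous_add_both c Q
  set ν : Measure Ω := (c : Measure Ω) + (Q : Measure Ω)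
  have hWν : ∀ W ∈ p.support, (W : Measure Ω) ≪ ν := fun W hW =>
    (hc ▸ absolutelyContinuous_mixture hW).trans hcν
  have hm : ∀ P R : Measure Ω, Measurable fun y => kernel 1 (P.rnDeriv ν y) (R.rnDeriv ν y) :=
    fun P R => measurable_kernel_comp 1 (Measure.measurable_rnDeriv _ _)
      (Measure.measurable_rnDeriv _ _)
  have hsum : ∀ R : ProbabilityMeasure Ω, (R : Measure Ω) ≪ ν →
      ∑ W ∈ p.support, (p W : ℝ≥0∞) * hellingerDiv 1 W R
        = ∫⁻ y, ∑ W ∈ p.support, (p W : ℝ≥0∞)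
          * kernel 1 ((W : Measure Ω).rnDeriv ν y) ((R : Measure Ω).rnDeriv ν y) ∂ν := by
    intro R hR
    rw [lintegral_finsetSum _ fun W _ => (hm _ _).const_mul _]
    refine Finset.sum_congr rfl fun W hW => ?_
    rw [lintegral_const_mul _ (hm _ _), hellingerDiv_eq_lintegral one_pos W R ν (hWν W hW) hR]
  rw [hsum Q hQν, hsum c hcν, hellingerDiv_eq_lintegral one_pos c Q ν hcν hQν,
    ← lintegral_add_right _ (hm _ _)]
  apply lintegral_congr_ae
  have hfin : ∀ᵐ y ∂ν, ∀ W ∈ p.support, (W : Measure Ω).rnDeriv ν y ≠ ∞ := by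
    rw [Finset.eventually_all]
    exact fun W _ => Measure.rnDeriv_ne_top _ _
  filter_upwards [ae_sum_mul_rnDeriv hp ν, hfin, Measure.rnDeriv_ne_top (c : Measure Ω) ν,
    Measure.rnDeriv_ne_top (Q : Measure Ω) ν] with y h1 h2 h3 h4
  rw [← hc] at h1
  exact sum_mul_kernel_one (sum_coe_eq_one hp) (fun W hW => coe_ne_zero_of_mem_support hW) h2 h3 h4
    h1

/-- The mutual information is the average divergence from the mixture, and it is finite because the
densities with respect to the mixture are bounded. -/
lemma exists_information_one_eq {p : ProbabilityMeasure Ω →₀ ℝ≥0}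
    {𝒲 : Set (ProbabilityMeasure Ω)} (hp : p ∈ priors 𝒲) {c : ProbabilityMeasure Ω}
    (hc : (c : Measure Ω) = mixture p) :
    ∃ i : ℝ, 0 ≤ i ∧ information 1 p = i ∧
      ∑ W ∈ p.support, (p W : ℝ≥0∞) * hellingerDiv 1 W c = ENNReal.ofReal i := by
  have := isProbabilityMeasure_mixture hp
  have hbound : ∀ W ∈ p.support, ∀ᵐ y ∂mixture p, density p W y ≤ ((p W : ℝ≥0∞))⁻¹ := by
    intro W hW
    filter_upwards [ae_sum_mul_density hp] with y hy
    rw [ENNReal.le_inv_iff_mul_le, mul_comm, ← hy]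
    exact Finset.single_le_sum (f := fun W => (p W : ℝ≥0∞) * density p W y)
      (fun _ _ => zero_le) hW
  have hmeas : ∀ W, Measurable fun y => InformationTheory.klFun (density p W y).toReal := fun W =>
    InformationTheory.measurable_klFun.comp (measurable_density p W).ennreal_toReal
  have hint : ∀ W ∈ p.support,
      Integrable (fun y => InformationTheory.klFun (density p W y).toReal) (mixture p) := by
    intro W hW
    have hpW : (p W : ℝ≥0∞)⁻¹ ≠ ∞ := ENNReal.inv_ne_top.2 (coe_ne_zero_of_mem_support hW)
    obtain ⟨K, hK⟩ := isCompact_Icc.exists_bound_of_continuousOn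
      (InformationTheory.continuous_klFun.continuousOn (s := Set.Icc 0 ((p W : ℝ≥0∞)⁻¹).toReal))
    refine Integrable.of_bound (hmeas W).aestronglyMeasurable K ?_
    filter_upwards [hbound W hW] with y hy
    exact hK _ ⟨ENNReal.toReal_nonneg, ENNReal.toReal_mono hpW hy⟩
  set F : Ω → ℝ := fun y => ∑ W ∈ p.support, (p W : ℝ)
    * InformationTheory.klFun (density p W y).toReal with hF
  have hFint : Integrable F (mixture p) :=
    integrable_finsetSum _ fun W hW => (hint W hW).const_mul _
  have hF0 : ∀ y, 0 ≤ F y := fun y => Finset.sum_nonneg fun W _ =>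
    mul_nonneg NNReal.zero_le_coe (InformationTheory.klFun_nonneg ENNReal.toReal_nonneg)
  refine ⟨∫ y, F y ∂mixture p, integral_nonneg hF0, ?_, ?_⟩
  · simp only [information]
    rw [if_neg one_ne_zero, if_pos trivial]
    congr 1
    apply integral_congr_ae
    have hfin : ∀ᵐ y ∂mixture p, ∀ W ∈ p.support, density p W y ≠ ∞ := by
      rw [Finset.eventually_all]
      exact fun W _ => Measure.rnDeriv_ne_top _ _
    filter_upwards [ae_sum_mul_density hp, hfin] with y h1 h2
    have h3 := congrArg ENNReal.toReal h1
    rw [ENNReal.toReal_sum fun W hW => ENNReal.mul_ne_top ENNReal.coe_ne_top (h2 W hW),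
      ENNReal.toReal_one] at h3
    simp only [ENNReal.toReal_mul, ENNReal.coe_toReal] at h3
    have h4 : ∑ W ∈ p.support, (p W : ℝ) = 1 := by exact_mod_cast hp.2
    have h5 : F y = ∑ W ∈ p.support, (p W : ℝ) * (density p W y).toReal
        * Real.log (density p W y).toReal + (∑ W ∈ p.support, (p W : ℝ)
          - ∑ W ∈ p.support, (p W : ℝ) * (density p W y).toReal) := by
      rw [hF, ← Finset.sum_sub_distrib, ← Finset.sum_add_distrib]
      refine Finset.sum_congr rfl fun W _ => ?_
      rw [InformationTheory.klFun_apply]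
      ring
    rw [h5, h3, h4, sub_self, add_zero]
    refine Finset.sum_congr rfl fun W hW => ?_
    have h6 : (p W : ℝ) ≠ 0 := by simpa using hW
    rw [posterior, ENNReal.toReal_mul, ENNReal.coe_toReal, mul_div_cancel_left₀ _ h6]
  · rw [ofReal_integral_eq_lintegral_ofReal hFint (Eventually.of_forall hF0)]
    have h1 : ∀ y, ENNReal.ofReal (F y) = ∑ W ∈ p.support, (p W : ℝ≥0∞)
        * ENNReal.ofReal (InformationTheory.klFun (density p W y).toReal) := by
      intro y
      rw [hF, ENNReal.ofReal_sum_of_nonneg fun W _ => mul_nonneg NNReal.zero_le_coe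
        (InformationTheory.klFun_nonneg ENNReal.toReal_nonneg)]
      refine Finset.sum_congr rfl fun W _ => ?_
      rw [ENNReal.ofReal_mul NNReal.zero_le_coe, ENNReal.ofReal_coe_nnreal]
    simp only [h1]
    rw [lintegral_finsetSum _ fun W _ => (hmeas W).ennreal_ofReal.const_mul _]
    refine Finset.sum_congr rfl fun W hW => ?_
    rw [lintegral_const_mul _ (hmeas W).ennreal_ofReal, hellingerDiv_one,
      InformationTheory.klDiv_eq_lintegral_klFun, hc, if_pos (absolutelyContinuous_mixture hW)]
    rfl

/-- **Sibson's identity** for every finite order, in terms of the Hellinger divergence: the average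
divergence from `Q` splits into a term given by the information of the prior and a multiple of the
divergence of the center from `Q`. -/
theorem exists_sibson {a : ℝ} (ha : 0 < a) {p : ProbabilityMeasure Ω →₀ ℝ≥0}
    {𝒲 : Set (ProbabilityMeasure Ω)} (hp : p ∈ priors 𝒲) :
    ∃ (c : ProbabilityMeasure Ω) (i : ℝ), 0 ≤ i ∧ information (ENNReal.ofReal a) p = i ∧
      ∀ Q, ∑ W ∈ p.support, (p W : ℝ≥0∞) * hellingerDiv a W Q
        = ENNReal.ofReal (toHellinger a i)
          + ENNReal.ofReal (Real.exp ((a - 1) * i)) * hellingerDiv a c Q := by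
  rcases eq_or_ne a 1 with rfl | ha1
  · obtain ⟨c, hc⟩ : ∃ c : ProbabilityMeasure Ω, (c : Measure Ω) = mixture p :=
      ⟨⟨mixture p, isProbabilityMeasure_mixture hp⟩, rfl⟩
    obtain ⟨i, hi0, hi, hsum⟩ := exists_information_one_eq hp hc
    refine ⟨c, i, hi0, by rw [ENNReal.ofReal_one, hi], fun Q => ?_⟩
    rw [sum_mul_hellingerDiv_one hp hc Q, hsum, toHellinger_one]
    simp
  · exact exists_sibson_of_ne_one ha ha1 hp

/-! ### Mixtures of priors -/

lemma single_mem_priors {𝒲 : Set (ProbabilityMeasure Ω)} {W : ProbabilityMeasure Ω} (hW : W ∈ 𝒲) :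
    Finsupp.single W (1 : ℝ≥0) ∈ priors 𝒲 := by
  have hs : (Finsupp.single W (1 : ℝ≥0)).support = {W} :=
    Finsupp.support_single W one_ne_zero
  refine ⟨?_, ?_⟩
  · rw [hs]
    simpa using hW
  · rw [hs]
    simp

lemma sum_mul_mix (s t : ℝ≥0) (p p' : ProbabilityMeasure Ω →₀ ℝ≥0)
    (f : ProbabilityMeasure Ω → ℝ≥0∞) :
    ∑ W ∈ (s • p + t • p').support, ((s • p + t • p') W : ℝ≥0∞) * f W
      = s * ∑ W ∈ p.support, (p W : ℝ≥0∞) * f W + t * ∑ W ∈ p'.support, (p' W : ℝ≥0∞) * f W := by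
  classical
  have hsub : (s • p + t • p').support ⊆ p.support ∪ p'.support :=
    Finsupp.support_add.trans (Finset.union_subset_union Finsupp.support_smul Finsupp.support_smul)
  have hext : ∀ q : ProbabilityMeasure Ω →₀ ℝ≥0, q.support ⊆ p.support ∪ p'.support →
      ∑ W ∈ q.support, (q W : ℝ≥0∞) * f W = ∑ W ∈ p.support ∪ p'.support, (q W : ℝ≥0∞) * f W :=
    fun q hq => Finset.sum_subset hq fun W _ hW => by
      rw [Finsupp.notMem_support_iff.1 hW, ENNReal.coe_zero, zero_mul]
  rw [hext _ hsub, hext p Finset.subset_union_left, hext p' Finset.subset_union_right,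
    Finset.mul_sum, Finset.mul_sum, ← Finset.sum_add_distrib]
  refine Finset.sum_congr rfl fun W _ => ?_
  simp only [Finsupp.add_apply, Finsupp.smul_apply, smul_eq_mul, ENNReal.coe_add, ENNReal.coe_mul]
  ring

lemma mix_mem_priors {𝒲 : Set (ProbabilityMeasure Ω)} {p p' : ProbabilityMeasure Ω →₀ ℝ≥0}
    (hp : p ∈ priors 𝒲) (hp' : p' ∈ priors 𝒲) {s t : ℝ≥0} (hst : s + t = 1) :
    s • p + t • p' ∈ priors 𝒲 := by
  classical
  refine ⟨fun W hW => ?_, ?_⟩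
  · have h1 := Finsupp.support_add hW
    rcases Finset.mem_union.1 h1 with h | h
    · exact hp.1 (Finsupp.support_smul h)
    · exact hp'.1 (Finsupp.support_smul h)
  · have h := sum_mul_mix s t p p' fun _ => 1
    simp only [mul_one, sum_coe_eq_one hp, sum_coe_eq_one hp'] at h
    have h2 : (s : ℝ≥0∞) + t = 1 := by exact_mod_cast hst
    rw [h2] at h
    exact_mod_cast h

/-! ### Finite orders -/

/-- An inequality between extended nonnegative reals that forces the unknowns to be finite, read
off in the reals. -/
lemma toReal_of_mix_le {s t x y e f K : ℝ} {H J : ℝ≥0∞} (hs : 0 < s) (ht : 0 < t) (hx : 0 ≤ x)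
    (hy : 0 ≤ y) (he : 0 < e) (hf : 0 < f) (hK : 0 ≤ K)
    (h : ENNReal.ofReal s * (ENNReal.ofReal x + ENNReal.ofReal e * H)
      + ENNReal.ofReal t * (ENNReal.ofReal y + ENNReal.ofReal f * J) ≤ ENNReal.ofReal K) :
    H ≠ ∞ ∧ J ≠ ∞ ∧ s * (x + e * H.toReal) + t * (y + f * J.toReal) ≤ K := by
  have hne : ∀ z : ℝ, 0 < z → ENNReal.ofReal z ≠ 0 := fun z hz => (ENNReal.ofReal_pos.2 hz).ne'
  have hH : H ≠ ∞ := by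
    rintro rfl
    rw [ENNReal.mul_top (hne e he), add_top, ENNReal.mul_top (hne s hs), top_add] at h
    exact ENNReal.ofReal_ne_top (top_le_iff.1 h)
  have hJ : J ≠ ∞ := by
    rintro rfl
    rw [ENNReal.mul_top (hne f hf), add_top, ENNReal.mul_top (hne t ht), add_top] at h
    exact ENNReal.ofReal_ne_top (top_le_iff.1 h)
  refine ⟨hH, hJ, ?_⟩
  rw [← ENNReal.ofReal_toReal hH, ← ENNReal.ofReal_toReal hJ, ← ENNReal.ofReal_mul he.le,
    ← ENNReal.ofReal_mul hf.le, ← ENNReal.ofReal_add hx (by positivity),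
    ← ENNReal.ofReal_add hy (by positivity), ← ENNReal.ofReal_mul hs.le,
    ← ENNReal.ofReal_mul ht.le, ← ENNReal.ofReal_add (by positivity) (by positivity)] at h
  exact (ENNReal.ofReal_le_ofReal_iff hK).1 h

/-- Averaging over a mixture of two priors, with the center of the mixture as second argument: the
result is given by the information of the mixture, hence bounded by the capacity. -/
lemma exists_mix_le {a : ℝ} (ha : 0 < a) {𝒲 : Set (ProbabilityMeasure Ω)} {C : ℝ}
    (hC : ∀ p ∈ priors 𝒲, information (ENNReal.ofReal a) p ≤ C)
    {p p' : ProbabilityMeasure Ω →₀ ℝ≥0} (hp : p ∈ priors 𝒲) (hp' : p' ∈ priors 𝒲) {s t : ℝ}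
    (hs : 0 ≤ s) (ht : 0 ≤ t) (hst : s + t = 1) :
    ∃ Q, ENNReal.ofReal s * ∑ W ∈ p.support, (p W : ℝ≥0∞) * hellingerDiv a W Q
      + ENNReal.ofReal t * ∑ W ∈ p'.support, (p' W : ℝ≥0∞) * hellingerDiv a W Q
        ≤ ENNReal.ofReal (toHellinger a C) := by
  lift s to ℝ≥0 using hs
  lift t to ℝ≥0 using ht
  have hmix := mix_mem_priors hp hp' (s := s) (t := t) (by exact_mod_cast hst)
  obtain ⟨Q, i, _, hi, hQ⟩ := exists_sibson ha hmix
  refine ⟨Q, ?_⟩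
  have h := hQ Q
  rw [sum_mul_mix, hellingerDiv_self ha, mul_zero, add_zero] at h
  rw [ENNReal.ofReal_coe_nnreal, ENNReal.ofReal_coe_nnreal, h]
  have h2 := hC _ hmix
  rw [hi, EReal.coe_le_coe_iff] at h2
  exact ENNReal.ofReal_le_ofReal ((strictMono_toHellinger a).monotone h2)

lemma exists_pos_toHellinger_sub_lt (a C : ℝ) {β : ℝ} (hβ : 0 < β) :
    ∃ ε : ℝ, 0 < ε ∧ ∀ i, C - ε ≤ i → toHellinger a C - β ≤ toHellinger a i := by
  obtain ⟨ε, hε, h⟩ := Metric.continuous_iff.1 (continuous_toHellinger a) C β hβ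
  refine ⟨ε / 2, by positivity, fun i hi => ?_⟩
  have h1 := h (C - ε / 2) (by rw [Real.dist_eq, abs_lt]; constructor <;> linarith)
  rw [Real.dist_eq, abs_lt] at h1
  have h2 := (strictMono_toHellinger a).monotone hi
  linarith [h1.1]

theorem center_ofReal {a : ℝ} (ha : 0 < a) {𝒲 : Set (ProbabilityMeasure Ω)} (h𝒲 : 𝒲.Nonempty)
    {C : ℝ} (hC : capacity (ENNReal.ofReal a) 𝒲 = C) :
    capacity (ENNReal.ofReal a) 𝒲 = radius (ENNReal.ofReal a) 𝒲 ∧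
    (∃! q, IsCenter (ENNReal.ofReal a) 𝒲 q) ∧
    ∀ q, IsCenter (ENNReal.ofReal a) 𝒲 q → ∀ Q, capacity (ENNReal.ofReal a) 𝒲
      + divergence (ENNReal.ofReal a) q Q ≤ ⨆ W ∈ 𝒲, divergence (ENNReal.ofReal a) W Q := by
  obtain ⟨W₀, hW₀⟩ := h𝒲
  have : Nonempty (ProbabilityMeasure Ω) := ⟨W₀⟩
  have hIC : ∀ p ∈ priors 𝒲, information (ENNReal.ofReal a) p ≤ C := fun p hp =>
    hC ▸ le_iSup₂ (f := fun p (_ : p ∈ priors 𝒲) => information (ENNReal.ofReal a) p) p hp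
  choose! c i hi0 hi hsib using fun (p : ProbabilityMeasure Ω →₀ ℝ≥0) (hp : p ∈ priors 𝒲) =>
    exists_sibson ha hp
  have hiC : ∀ p ∈ priors 𝒲, i p ≤ C := fun p hp => by
    have := hIC p hp
    rwa [hi p hp, EReal.coe_le_coe_iff] at this
  have hC0 : 0 ≤ C := (hi0 _ (single_mem_priors hW₀)).trans (hiC _ (single_mem_priors hW₀))
  set κ := toHellinger a with hκ
  have hκm : StrictMono κ := strictMono_toHellinger a
  have hκ0 : ∀ {r : ℝ}, 0 ≤ r → 0 ≤ κ r := fun hr => toHellinger_nonneg a hr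
  have hκpos : ∀ {r : ℝ}, 0 < r → 0 < κ r := fun hr => toHellinger_zero a ▸ hκm hr
  have hDle : ∀ P Q : ProbabilityMeasure Ω, ∀ r : ℝ, 0 ≤ r → hellingerDiv a P Q ≠ ∞ →
      (hellingerDiv a P Q).toReal ≤ κ r → divergence (ENNReal.ofReal a) P Q ≤ r := by
    intro P Q r hr htop h
    rw [divergence_le_coe_iff ha P Q hr]
    exact (ENNReal.le_ofReal_iff_toReal_le htop (hκ0 hr)).2 h
  -- a lower bound for the factors in Sibson's identity
  obtain ⟨m, hm, hmle⟩ : ∃ m : ℝ, 0 < m ∧ ∀ p ∈ priors 𝒲, m ≤ Real.exp ((a - 1) * i p) := by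
    refine ⟨Real.exp (-(|a - 1| * C)), Real.exp_pos _, fun p hp => Real.exp_le_exp.2 ?_⟩
    have h1 : |a - 1| * i p ≤ |a - 1| * C := by
      gcongr
      exact hiC p hp
    have h2 : -|a - 1| * i p ≤ (a - 1) * i p :=
      mul_le_mul_of_nonneg_right (neg_abs_le _) (hi0 p hp)
    linarith
  unfold radius relativeRadius IsCenter
  rw [hC]
  refine center_of_sibson (c := c) (I := information (ENNReal.ofReal a))
    ⟨_, single_mem_priors hW₀⟩ hC (divergence_nonneg ha) ?_ ?_ ?_ ?_ ?_
  · intro p hp Q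
    have hle : ∀ W ∈ 𝒲, divergence (ENNReal.ofReal a) W Q
        ≤ ⨆ W ∈ 𝒲, divergence (ENNReal.ofReal a) W Q := fun W hW =>
      le_iSup₂ (f := fun W (_ : W ∈ 𝒲) => divergence (ENNReal.ofReal a) W Q) W hW
    have hL0 := (divergence_nonneg ha W₀ Q).trans (hle W₀ hW₀)
    induction hL : (⨆ W ∈ 𝒲, divergence (ENNReal.ofReal a) W Q) with
    | bot => rw [hL] at hL0; simp at hL0
    | top => exact le_top
    | coe L =>
      rw [hL] at hL0 hle
      have hL0' : 0 ≤ L := by exact_mod_cast hL0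
      have h1 : ∑ W ∈ p.support, (p W : ℝ≥0∞) * hellingerDiv a W Q ≤ ENNReal.ofReal (κ L) := by
        calc _ ≤ ∑ W ∈ p.support, (p W : ℝ≥0∞) * ENNReal.ofReal (κ L) := by
              refine Finset.sum_le_sum fun W hW => ?_
              gcongr
              exact (divergence_le_coe_iff ha W Q hL0').1 (hle W (hp.1 hW))
          _ = _ := by rw [← Finset.sum_mul, sum_coe_eq_one hp, one_mul]
      rw [hsib p hp Q] at h1
      -- the same inequality with weights one half, for the extraction of real numbers
      have h2 := toReal_of_mix_le (s := 1 / 2) (t := 1 / 2) (by norm_num) (by norm_num)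
        (hκ0 (hi0 p hp)) (hκ0 (hi0 p hp)) (Real.exp_pos _) (Real.exp_pos _) (hκ0 hL0')
        (by rw [← add_mul, ← ENNReal.ofReal_add (by norm_num) (by norm_num), add_halves,
              ENNReal.ofReal_one, one_mul]
            exact h1)
      obtain ⟨htop, _, h3⟩ := h2
      have h4 : κ (i p) + Real.exp ((a - 1) * i p) * (hellingerDiv a (c p) Q).toReal ≤ κ L := by
        linarith
      have h5 : i p ≤ L := by
        rw [← hκm.le_iff_le]
        have : 0 ≤ Real.exp ((a - 1) * i p) * (hellingerDiv a (c p) Q).toReal := by positivity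
        linarith
      have h6 : (hellingerDiv a (c p) Q).toReal ≤ κ (L - i p) := by
        have h7 := toHellinger_add a (i p) (L - i p)
        rw [add_sub_cancel, ← hκ] at h7
        rw [h7] at h4
        exact le_of_mul_le_mul_left (by linarith) (Real.exp_pos ((a - 1) * i p))
      have h8 := hDle (c p) Q (L - i p) (by linarith) htop h6
      rw [hi p hp]
      calc (i p : EReal) + divergence (ENNReal.ofReal a) (c p) Q
          ≤ (i p : EReal) + ((L - i p : ℝ) : EReal) := by gcongr
        _ = L := by rw [← EReal.coe_add, add_sub_cancel]
  · intro δ hδ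
    have hβ : 0 < m * κ δ / 2 := by have := hκpos hδ; positivity
    obtain ⟨ε, hε, hεi⟩ := exists_pos_toHellinger_sub_lt a C hβ
    refine ⟨ε, hε, fun p hp p' hp' hI hI' => ?_⟩
    rw [hi p hp, EReal.coe_le_coe_iff] at hI
    rw [hi p' hp', EReal.coe_le_coe_iff] at hI'
    obtain ⟨Q, hQ⟩ := exists_mix_le ha hIC hp hp' (s := 1 / 2) (t := 1 / 2) (by norm_num)
      (by norm_num) (by norm_num)
    rw [hsib p hp, hsib p' hp'] at hQ
    obtain ⟨h1, h2, h3⟩ := toReal_of_mix_le (by norm_num) (by norm_num) (hκ0 (hi0 p hp))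
      (hκ0 (hi0 p' hp')) (Real.exp_pos _) (Real.exp_pos _) (hκ0 hC0) hQ
    have h4 := hεi _ hI
    have h5 := hεi _ hI'
    have h6 := mul_le_mul_of_nonneg_right (hmle p hp)
      (ENNReal.toReal_nonneg (a := hellingerDiv a (c p) Q))
    have h7 := mul_le_mul_of_nonneg_right (hmle p' hp')
      (ENNReal.toReal_nonneg (a := hellingerDiv a (c p') Q))
    have h8 := mul_nonneg hm.le (ENNReal.toReal_nonneg (a := hellingerDiv a (c p) Q))
    have h9 := mul_nonneg hm.le (ENNReal.toReal_nonneg (a := hellingerDiv a (c p') Q))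
    refine ⟨Q, hDle _ _ _ hδ.le h1 (le_of_mul_le_mul_left ?_ hm),
      hDle _ _ _ hδ.le h2 (le_of_mul_le_mul_left ?_ hm)⟩ <;> linarith
  · intro δ hδ
    have hκδ := hκpos hδ
    -- the weight of the added point mass
    obtain ⟨t, ht0, ht1, htC⟩ : ∃ t : ℝ, 0 < t ∧ t ≤ 1 / 2 ∧ t * κ C ≤ m * κ δ / 4 := by
      have hκC := hκ0 hC0
      refine ⟨min (1 / 2) (m * κ δ / 4 / (κ C + 1)), lt_min (by norm_num) (by positivity),
        min_le_left _ _, ?_⟩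
      calc min (1 / 2) (m * κ δ / 4 / (κ C + 1)) * κ C
          ≤ m * κ δ / 4 / (κ C + 1) * (κ C + 1) :=
            mul_le_mul (min_le_right _ _) (by linarith) hκC (by positivity)
        _ = m * κ δ / 4 := by field_simp
    have hCδ : κ C < κ (C + δ) := hκm (by linarith)
    have hβ : 0 < min (m * κ δ / 4) (t * (κ (C + δ) - κ C)) :=
      lt_min (by positivity) (mul_pos ht0 (by linarith))
    set β := min (m * κ δ / 4) (t * (κ (C + δ) - κ C))
    have hβ1 : β ≤ m * κ δ / 4 := min_le_left _ _
    have hβ2 : β ≤ t * (κ (C + δ) - κ C) := min_le_right _ _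
    obtain ⟨ε, hε, hεi⟩ := exists_pos_toHellinger_sub_lt a C hβ
    refine ⟨ε, hε, fun p hp W hW hI => ?_⟩
    rw [hi p hp, EReal.coe_le_coe_iff] at hI
    obtain ⟨Q, hQ⟩ := exists_mix_le ha hIC hp (single_mem_priors hW) (s := 1 - t) (t := t)
      (by linarith) ht0.le (by ring)
    have hsingle : ∑ V ∈ (Finsupp.single W (1 : ℝ≥0)).support,
        (Finsupp.single W (1 : ℝ≥0) V : ℝ≥0∞) * hellingerDiv a V Q
        = ENNReal.ofReal 0 + ENNReal.ofReal 1 * hellingerDiv a W Q := by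
      rw [Finsupp.support_single W one_ne_zero]
      simp
    rw [hsib p hp, hsingle] at hQ
    obtain ⟨h1, h2, h3⟩ := toReal_of_mix_le (by linarith) ht0 (hκ0 (hi0 p hp)) le_rfl
      (Real.exp_pos _) one_pos (hκ0 hC0) hQ
    have h4 := hεi _ hI
    rw [zero_add, one_mul] at h3
    have h6 := mul_le_mul_of_nonneg_right (hmle p hp)
      (ENNReal.toReal_nonneg (a := hellingerDiv a (c p) Q))
    set x := (hellingerDiv a (c p) Q).toReal
    set y := (hellingerDiv a W Q).toReal
    have hx : 0 ≤ m * x := mul_nonneg hm.le ENNReal.toReal_nonneg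
    have hy : 0 ≤ t * y := mul_nonneg ht0.le ENNReal.toReal_nonneg
    have h7 : (1 - t) * (κ C - β + m * x) + t * y ≤ κ C := by
      have : (1 - t) * (κ C - β + m * x)
          ≤ (1 - t) * (κ (i p) + Real.exp ((a - 1) * i p) * x) :=
        mul_le_mul_of_nonneg_left (by linarith) (by linarith)
      linarith
    have h8 : (1 - t) * (m * x) + t * y ≤ t * κ C + β := by nlinarith
    refine ⟨Q, hDle _ _ _ (by linarith) h2 ?_, hDle _ _ _ hδ.le h1 ?_⟩
    · have h9 : 0 ≤ (1 - t) * (m * x) := mul_nonneg (by linarith) hx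
      exact le_of_mul_le_mul_left (by linarith : t * y ≤ t * κ (C + δ)) ht0
    · have h9 : 1 / 2 * (m * x) ≤ (1 - t) * (m * x) :=
        mul_le_mul_of_nonneg_right (by linarith) hx
      exact le_of_mul_le_mul_left (by linarith : m * x ≤ m * κ δ) hm
  · intro η hη
    obtain ⟨δ, hδ, h⟩ := exists_tvClose_of_hellingerDiv_le (Ω := Ω) ha hη
    -- a value `r` with `κ r ≤ δ`
    obtain ⟨r, hr, hrδ⟩ : ∃ r : ℝ, 0 < r ∧ κ r ≤ δ := by
      obtain ⟨ε, hε, hcont⟩ := Metric.continuous_iff.1 (continuous_toHellinger a) 0 δ hδ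
      refine ⟨ε / 2, by positivity, ?_⟩
      have h1 := hcont (ε / 2) (by rw [Real.dist_eq, abs_lt]; constructor <;> linarith)
      rw [Real.dist_eq, toHellinger_zero, sub_zero] at h1
      exact (le_abs_self _).trans h1.le
    exact ⟨r, hr, fun P Q hPQ => h P Q (((divergence_le_coe_iff ha P Q hr.le).1 hPQ).trans
      (ENNReal.ofReal_le_ofReal hrδ))⟩
  · intro P Q r hr h
    rw [divergence_le_coe_iff ha P Q hr]
    refine hellingerDiv_le_of_tvClose ha fun η hη => ?_
    obtain ⟨P', Q', h1, h2, h3⟩ := h η hη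
    exact ⟨P', Q', h1, h2, (divergence_le_coe_iff ha P' Q' hr).1 h3⟩

/-! ### Order infinity -/

/-- The divergence of infinite order compares the two measures setwise. -/
lemma divergence_top_le_iff (P Q : ProbabilityMeasure Ω) (r : ℝ) :
    divergence ∞ P Q ≤ r ↔ (P : Measure Ω) ≤ ENNReal.ofReal (Real.exp r) • (Q : Measure Ω) := by
  obtain ⟨hP, hQ⟩ := absolutelyContinuous_add_both P Q
  set K := ENNReal.ofReal (Real.exp r) with hK
  have hK0 : K ≠ 0 := (ENNReal.ofReal_pos.2 (Real.exp_pos r)).ne'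
  have hKtop : K ≠ ∞ := ENNReal.ofReal_ne_top
  simp only [divergence]
  rw [if_neg ENNReal.top_ne_zero, if_neg ENNReal.top_ne_one, if_pos trivial, log_le_coe_iff, ← hK]
  set ν : Measure Ω := (P : Measure Ω) + (Q : Measure Ω)
  have hmP := Measure.measurable_rnDeriv (P : Measure Ω) ν
  have hmQ := Measure.measurable_rnDeriv (Q : Measure Ω) ν
  have h1 : essSup (fun y => (P : Measure Ω).rnDeriv ν y / (Q : Measure Ω).rnDeriv ν y) ν ≤ K ↔
      ∀ᵐ y ∂ν, (P : Measure Ω).rnDeriv ν y ≤ K * (Q : Measure Ω).rnDeriv ν y := by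
    constructor
    · intro h
      filter_upwards [ae_le_essSup (μ := ν) (f := fun y =>
        (P : Measure Ω).rnDeriv ν y / (Q : Measure Ω).rnDeriv ν y)] with y hy
      exact (ENNReal.div_le_iff_le_mul (Or.inr hKtop) (Or.inr hK0)).1 (hy.trans h)
    · intro h
      refine essSup_le_of_ae_le _ ?_
      filter_upwards [h] with y hy
      exact (ENNReal.div_le_iff_le_mul (Or.inr hKtop) (Or.inr hK0)).2 hy
  rw [h1]
  constructor
  · intro h
    refine Measure.le_iff.2 fun A _ => ?_
    rw [Measure.smul_apply, smul_eq_mul, ← Measure.setLIntegral_rnDeriv hP,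
      ← Measure.setLIntegral_rnDeriv hQ, ← lintegral_const_mul _ hmQ]
    exact lintegral_mono_ae (ae_restrict_of_ae h)
  · intro h
    refine ae_le_of_forall_setLIntegral_le_of_sigmaFinite hmP fun A _ _ => ?_
    rw [lintegral_const_mul _ hmQ, Measure.setLIntegral_rnDeriv hP, Measure.setLIntegral_rnDeriv hQ]
    exact h A

lemma divergence_top_le_iff_real (P Q : ProbabilityMeasure Ω) (r : ℝ) :
    divergence ∞ P Q ≤ r ↔ ∀ A : Set Ω, MeasurableSet A →
      (P : Measure Ω).real A ≤ Real.exp r * (Q : Measure Ω).real A := by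
  rw [divergence_top_le_iff, Measure.le_iff]
  refine forall₂_congr fun A _ => ?_
  rw [Measure.smul_apply, smul_eq_mul, ← ENNReal.toReal_le_toReal (measure_ne_top _ _)
    (ENNReal.mul_ne_top ENNReal.ofReal_ne_top (measure_ne_top _ _)), ENNReal.toReal_mul,
    ENNReal.toReal_ofReal (Real.exp_pos r).le, Measure.real, Measure.real]

lemma divergence_top_nonneg (P Q : ProbabilityMeasure Ω) : 0 ≤ divergence ∞ P Q := by
  refine EReal.le_of_forall_lt_iff_le.1 fun r hr => ?_
  have h := (divergence_top_le_iff_real P Q r).1 hr.le Set.univ MeasurableSet.univ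
  rw [probReal_univ, probReal_univ, mul_one] at h
  exact_mod_cast Real.one_le_exp_iff.1 h

/-- The mean measure of infinite order is the least measure above all members of the support. -/
lemma meanMeasure_top_le_iff {p : ProbabilityMeasure Ω →₀ ℝ≥0} {𝒲 : Set (ProbabilityMeasure Ω)}
    (hp : p ∈ priors 𝒲) (M : Measure Ω) [IsFiniteMeasure M] :
    meanMeasure ∞ p ≤ M ↔ ∀ W ∈ p.support, (W : Measure Ω) ≤ M := by
  have := isProbabilityMeasure_mixture hp
  constructor
  · intro h W hW
    refine le_trans ?_ h
    have hWd : (W : Measure Ω) = (mixture p).withDensity (density p W) :=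
      (Measure.withDensity_rnDeriv_eq _ _ (absolutelyContinuous_mixture hW)).symm
    rw [hWd, meanMeasure]
    refine withDensity_mono (Eventually.of_forall fun y => ?_)
    rw [meanDensity_top]
    exact Finset.le_sup (f := fun W => density p W y) hW
  · intro h
    have hle : ∀ᵐ y ∂mixture p, ∀ W ∈ p.support, density p W y ≤ M.rnDeriv (mixture p) y := by
      rw [Finset.eventually_all]
      intro W hW
      have hadd := Measure.rnDeriv_add (M - (W : Measure Ω)) (W : Measure Ω) (mixture p)
      rw [Measure.sub_add_cancel_of_le (h W hW)] at hadd
      filter_upwards [hadd] with y hy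
      rw [hy]
      exact le_add_self
    refine le_trans ?_ (Measure.withDensity_rnDeriv_le M (mixture p))
    rw [meanMeasure]
    refine withDensity_mono ?_
    filter_upwards [hle] with y hy
    rw [meanDensity_top]
    exact Finset.sup_le hy

/-- Sibson's identity at infinite order: the largest divergence from `Q` of a member of the support
is the sum of the information and the divergence of the center from `Q`. -/
lemma exists_sibson_top {p : ProbabilityMeasure Ω →₀ ℝ≥0} {𝒲 : Set (ProbabilityMeasure Ω)}
    (hp : p ∈ priors 𝒲) :
    ∃ (c : ProbabilityMeasure Ω) (i : ℝ), information ∞ p = i ∧ ∀ Q, ∀ r : ℝ,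
      divergence ∞ c Q ≤ ((r - i : ℝ) : EReal) ↔ ∀ W ∈ p.support, divergence ∞ W Q ≤ r := by
  have hα : (0 : ℝ≥0∞) < ∞ := ENNReal.zero_lt_top
  obtain ⟨c, hc⟩ := exists_normalized_meanMeasure hα hp
  have hN0 := meanMeasure_univ_ne_zero hα hp
  have hNtop := meanMeasure_univ_ne_top hα hp
  have hI : information ∞ p = ENNReal.log (meanMeasure ∞ p Set.univ) := by
    simp [information]
  set N := meanMeasure ∞ p Set.univ
  have hpos : 0 < N.toReal := ENNReal.toReal_pos hN0 hNtop
  refine ⟨c, Real.log N.toReal, by rw [hI, ENNReal.log_pos_real hN0 hNtop], fun Q r => ?_⟩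
  have hfin : IsFiniteMeasure (ENNReal.ofReal (Real.exp r) • (Q : Measure Ω)) :=
    Measure.smul_finite _ ENNReal.ofReal_ne_top
  have hmean : meanMeasure ∞ p = N • (c : Measure Ω) := by
    rw [hc, smul_smul, ENNReal.mul_inv_cancel hN0 hNtop, one_smul]
  have hexp : ENNReal.ofReal (Real.exp r)
      = N * ENNReal.ofReal (Real.exp (r - Real.log N.toReal)) := by
    nth_rewrite 1 [← ENNReal.ofReal_toReal hNtop]
    rw [← ENNReal.ofReal_mul hpos.le, Real.exp_sub, Real.exp_log hpos, mul_div_cancel₀ _ hpos.ne']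
  have h1 : (∀ W ∈ p.support, divergence ∞ W Q ≤ r) ↔
      meanMeasure ∞ p ≤ ENNReal.ofReal (Real.exp r) • (Q : Measure Ω) := by
    rw [meanMeasure_top_le_iff hp]
    exact forall₂_congr fun W _ => divergence_top_le_iff W Q r
  rw [h1, divergence_top_le_iff, hmean, hexp, Measure.le_iff, Measure.le_iff]
  refine forall₂_congr fun A _ => ?_
  simp only [Measure.smul_apply, smul_eq_mul]
  rw [mul_assoc]
  exact (ENNReal.mul_le_mul_iff_right hN0 hNtop).symm

lemma support_mix {s t : ℝ≥0} (hs : s ≠ 0) (ht : t ≠ 0) (p p' : ProbabilityMeasure Ω →₀ ℝ≥0)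
    {W : ProbabilityMeasure Ω} (hW : W ∈ p.support ∨ W ∈ p'.support) :
    W ∈ (s • p + t • p').support := by
  simp only [Finsupp.mem_support_iff, Finsupp.add_apply, Finsupp.smul_apply, smul_eq_mul, ne_eq,
    add_eq_zero, mul_eq_zero, not_and_or, not_or] at hW ⊢
  exact hW.imp (fun h => ⟨hs, h⟩) fun h => ⟨ht, h⟩

theorem center_top {𝒲 : Set (ProbabilityMeasure Ω)} (h𝒲 : 𝒲.Nonempty)
    {C : ℝ} (hC : capacity ∞ 𝒲 = C) :
    capacity ∞ 𝒲 = radius ∞ 𝒲 ∧ (∃! q, IsCenter ∞ 𝒲 q) ∧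
    ∀ q, IsCenter ∞ 𝒲 q → ∀ Q,
      capacity ∞ 𝒲 + divergence ∞ q Q ≤ ⨆ W ∈ 𝒲, divergence ∞ W Q := by
  obtain ⟨W₀, hW₀⟩ := h𝒲
  have : Nonempty (ProbabilityMeasure Ω) := ⟨W₀⟩
  choose! c i hi hsib using fun (p : ProbabilityMeasure Ω →₀ ℝ≥0) (hp : p ∈ priors 𝒲) =>
    exists_sibson_top hp
  have hiC : ∀ p ∈ priors 𝒲, i p ≤ C := fun p hp => by
    have : information ∞ p ≤ C :=
      hC ▸ le_iSup₂ (f := fun p (_ : p ∈ priors 𝒲) => information ∞ p) p hp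
    rwa [hi p hp, EReal.coe_le_coe_iff] at this
  -- the center of a mixture of two priors is within the capacity of all members of both supports
  have hmix : ∀ p ∈ priors 𝒲, ∀ p' ∈ priors 𝒲, ∃ Q, ∀ W, W ∈ p.support ∨ W ∈ p'.support →
      divergence ∞ W Q ≤ C := by
    intro p hp p' hp'
    have hm := mix_mem_priors hp hp' (s := 1 / 2) (t := 1 / 2) (add_halves 1)
    refine ⟨c ((1 / 2 : ℝ≥0) • p + (1 / 2 : ℝ≥0) • p'), fun W hW => ?_⟩
    have h0 : divergence ∞ (c ((1 / 2 : ℝ≥0) • p + (1 / 2 : ℝ≥0) • p'))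
        (c ((1 / 2 : ℝ≥0) • p + (1 / 2 : ℝ≥0) • p')) ≤ ((0 : ℝ) : EReal) := by
      rw [divergence_top_le_iff]
      simp
    rw [← sub_self (i ((1 / 2 : ℝ≥0) • p + (1 / 2 : ℝ≥0) • p')), hsib _ hm] at h0
    refine (h0 W (support_mix (by norm_num) (by norm_num) p p' hW)).trans ?_
    exact_mod_cast hiC _ hm
  unfold radius relativeRadius IsCenter
  rw [hC]
  refine center_of_sibson (c := c) (I := information ∞)
    ⟨_, single_mem_priors hW₀⟩ hC divergence_top_nonneg ?_ ?_ ?_ ?_ ?_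
  · intro p hp Q
    have hle : ∀ W ∈ 𝒲, divergence ∞ W Q ≤ ⨆ W ∈ 𝒲, divergence ∞ W Q := fun W hW =>
      le_iSup₂ (f := fun W (_ : W ∈ 𝒲) => divergence ∞ W Q) W hW
    have hL0 := (divergence_top_nonneg W₀ Q).trans (hle W₀ hW₀)
    induction hL : (⨆ W ∈ 𝒲, divergence ∞ W Q) with
    | bot => rw [hL] at hL0; simp at hL0
    | top => exact le_top
    | coe L =>
      rw [hL] at hle
      have h1 := (hsib p hp Q L).2 fun W hW => hle W (hp.1 hW)
      rw [hi p hp]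
      calc (i p : EReal) + divergence ∞ (c p) Q ≤ (i p : EReal) + ((L - i p : ℝ) : EReal) := by
            gcongr
        _ = L := by rw [← EReal.coe_add, add_sub_cancel]
  · intro δ hδ
    refine ⟨δ, hδ, fun p hp p' hp' hI hI' => ?_⟩
    rw [hi p hp, EReal.coe_le_coe_iff] at hI
    rw [hi p' hp', EReal.coe_le_coe_iff] at hI'
    obtain ⟨Q, hQ⟩ := hmix p hp p' hp'
    refine ⟨Q, ((hsib p hp Q C).2 fun W hW => hQ W (Or.inl hW)).trans ?_,
      ((hsib p' hp' Q C).2 fun W hW => hQ W (Or.inr hW)).trans ?_⟩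
    · exact_mod_cast (by linarith : C - i p ≤ δ)
    · exact_mod_cast (by linarith : C - i p' ≤ δ)
  · intro δ hδ
    refine ⟨δ, hδ, fun p hp W hW hI => ?_⟩
    rw [hi p hp, EReal.coe_le_coe_iff] at hI
    obtain ⟨Q, hQ⟩ := hmix p hp _ (single_mem_priors hW)
    refine ⟨Q, (hQ W (Or.inr (by simp))).trans ?_,
      ((hsib p hp Q C).2 fun W hW => hQ W (Or.inl hW)).trans ?_⟩
    · exact_mod_cast (by linarith : C ≤ C + δ)
    · exact_mod_cast (by linarith : C - i p ≤ δ)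
  · intro η hη
    refine ⟨Real.log (1 + η), Real.log_pos (by linarith), fun P Q hPQ =>
      TVClose.of_le fun A hA => ?_⟩
    have h1 := (divergence_top_le_iff_real P Q _).1 hPQ A hA
    rw [Real.exp_log (by linarith)] at h1
    have h2 : (Q : Measure Ω).real A ≤ 1 := measureReal_le_one
    nlinarith
  · intro P Q r _ h
    refine (divergence_top_le_iff_real P Q r).2 fun A hA => le_of_forall_pos_le_add fun ε hε => ?_
    have hK : 0 < Real.exp r := Real.exp_pos r
    obtain ⟨P', Q', h1, h2, h3⟩ := h (ε / (1 + Real.exp r)) (by positivity)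
    have h4 := (divergence_top_le_iff_real P' Q' r).1 h3 A hA
    have h5 := (abs_le.1 (h1 A hA)).1
    have h6 := mul_le_mul_of_nonneg_left (abs_le.1 (h2 A hA)).2 hK.le
    have h7 : ε / (1 + Real.exp r) * (1 + Real.exp r) = ε := by field_simp
    nlinarith

lemma exists_capacity_eq_coe {α : ℝ≥0∞} (hα : 0 < α) {𝒲 : Set (ProbabilityMeasure Ω)}
    (h𝒲 : 𝒲.Nonempty) (hC : capacity α 𝒲 < ⊤) : ∃ C : ℝ, capacity α 𝒲 = C := by
  obtain ⟨W, hW⟩ := h𝒲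
  have hp := single_mem_priors hW
  obtain ⟨i, hi⟩ : ∃ i : ℝ, information α (Finsupp.single W 1) = i := by
    rcases eq_top_or_eq_ofReal hα with rfl | ⟨a, ha, rfl⟩
    · obtain ⟨_, i, hi, _⟩ := exists_sibson_top hp
      exact ⟨i, hi⟩
    · obtain ⟨_, i, _, hi, _⟩ := exists_sibson ha hp
      exact ⟨i, hi⟩
  have hle : (i : EReal) ≤ capacity α 𝒲 :=
    hi ▸ le_iSup₂ (f := fun p (_ : p ∈ priors 𝒲) => information α p) _ hp
  exact ⟨_, (EReal.coe_toReal hC.ne (ne_bot_of_le_ne_bot (EReal.coe_ne_bot i) hle)).symm⟩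

end Renyi

theorem mainTheorem2 {Ω : Type*} [MeasurableSpace Ω] (α : ℝ≥0∞) (hα : 0 < α)
    (𝒲 : Set (ProbabilityMeasure Ω)) (h𝒲 : 𝒲.Nonempty) (hC : Renyi.capacity α 𝒲 < ⊤) :
    Renyi.capacity α 𝒲 = Renyi.radius α 𝒲 ∧
    (∃! q : ProbabilityMeasure Ω, Renyi.IsCenter α 𝒲 q) ∧
    ∀ q : ProbabilityMeasure Ω, Renyi.IsCenter α 𝒲 q →
      ∀ Q : ProbabilityMeasure Ω,
        Renyi.capacity α 𝒲 + Renyi.divergence α q Q ≤ ⨆ W ∈ 𝒲, Renyi.divergence α W Q := by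
  obtain ⟨C, hCC⟩ := Renyi.exists_capacity_eq_coe hα h𝒲 hC
  rcases Renyi.eq_top_or_eq_ofReal hα with rfl | ⟨a, ha, rfl⟩
  · exact Renyi.center_top h𝒲 hCC
  · exact Renyi.center_ofReal ha h𝒲 hCC
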